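/- Let $G$ be a (finite-dimensional, real) Lie group, $N$ a normal Lie subgroup (embedded), $K=G/N$ the quotient Lie group, so that $\pi\colon G\to K$ is a submersion, and let $\mathfrak g,\mathfrak n,\mathfrak k$ be their Lie algebras, with $\mathfrak n\subseteq\mathfrak g$ and brackets defined by left-invariant vector fields. Fix a Riemannian metric on $G$ that is invariant under left translations. $G\to K$ is a left principal $N$-bundle; let $H_N(g)\subseteq T_gG$ be the orthogonal complement of the vertical space $\{\eta g:\eta\in\mathfrak n\}$, and let $\mathcal A_N$ be the corresponding connection form: $\mathcal A_N(v)$, for $v\in T_gG$, is the unique $\eta\in\mathfrak n$ with $v-\eta g\in H_N(g)$. For $\kappa\in\mathfrak k=T_eK$ let $\kappa^{\mathcal A_N}\in\mathfrak g$ be its horizontal lift at $e$, i.e. the unique vector of $H_N(e)$ with $T_e\pi(\kappa^{\mathcal A_N})=\kappa$. Let $\tilde{\mathfrak n}=(G\times\mathfrak n)/N\to K$ be the adjoint bundle, the quotient by $n\cdot(g,\eta)=(ng,\mathrm{Ad}_n\eta)$, with classes $[g,\eta]_N$ over $\pi(g)$ and fibrewise vector space structure $[g,\eta]_N+[g,\xi]_N=[g,\eta+\xi]_N$,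 $c[g,\eta]_N=[g,c\eta]_N$. For a smooth curve $x$ in $K$, parallel transport in $\tilde{\mathfrak n}$ along $x$ takes $[q(a),m]_N$ to $[q(b),m]_N$, where $q$ is a horizontal lift of $x$; the covariant derivative of a curve $c(t)\in\tilde{\mathfrak n}_{x(t)}$ is $$\frac{Dc(t)}{Dt}=\lim_{s\to0}\frac{\tau^{t+s}_{t}c(t+s)-c(t)}{s},$$ where $\tau^{t+s}_t$ is parallel transport from $x(t+s)$ back to $x(t)$, and for a section $v$ of $\tilde{\mathfrak n}$, $\nabla_Xv(k)=\frac{D}{Dt}v(x(t))$ for any smooth curve $x$ which passes through $k$ at time $t$ with velocity $X(k)$. The group $K$ acts on $\tilde{\mathfrak n}$ by $[g]_N[h,\eta]_N=[gh,\mathrm{Ad}_g\eta]_N$. For $\eta\in\mathfrak n$ let $\sigma_\eta([g]_N)=[g,\mathrm{Ad}_g\eta]_N$, a $K$-invariant section of $\tilde{\mathfrak n}$, and identify $\mathfrak n$ with $\tilde{\mathfrak n}/K$ by $\eta\equiv[\sigma_\eta]_K=[[e,\eta]_N]_K$. The reduced vertical covariant derivative of $\eta\in\mathfrak n$ in the direction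 $\kappa\in\mathfrak k$ is $$[\nabla^{(\mathcal A_N,V)}]_{K,\kappa}\,\eta:=[\nabla_{X_0}\sigma_\eta]_K\in\tilde{\mathfrak n}/K,$$ where $X_0$ is the left-invariant vector field on $K$ with $X_0(e)=\kappa$. Then: 1. $\mathcal A_N$ and $\kappa^{\mathcal A_N}$ are well defined, and $(\kappa,\eta)\mapsto\kappa^{\mathcal A_N}+\eta$ is a linear isomorphism $\mathfrak k\oplus\mathfrak n\to\mathfrak g$. 2. For all $\kappa\in\mathfrak k$ and $\eta\in\mathfrak n$, $[\kappa^{\mathcal A_N},\eta]\in\mathfrak n$, the reduced vertical covariant derivative exists and is uniquely determined, and under the identification $\mathfrak n\equiv\tilde{\mathfrak n}/K$ $$[\nabla^{(\mathcal A_N,V)}]_{K,\kappa}\,\eta\equiv[\kappa^{\mathcal A_N},\eta].$$ 3. With $b_N(\kappa,\eta):=[\kappa^{\mathcal A_N},\eta]\in\mathfrak n$ and $a_N(\kappa,\bar\kappa):=-\mathcal A_N([\kappa^{\mathcal A_N},\bar\kappa^{\mathcal A_N}])\in\mathfrak n$, and writing $\kappa\oplus\eta$ for $\kappa^{\mathcal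 A_N}+\eta\in\mathfrak g$, one has for all $\kappa,\bar\kappa\in\mathfrak k$ and $\eta,\bar\eta\in\mathfrak n$ $$[\kappa\oplus\eta,\bar\kappa\oplus\bar\eta]=[\kappa,\bar\kappa]\oplus\bigl(b_N(\kappa,\bar\eta)-b_N(\bar\kappa,\eta)-a_N(\kappa,\bar\kappa)+[\eta,\bar\eta]\bigr).$$ -/

import Mathlib

open Manifold Filter Topology
open scoped ContDiff

noncomputable section

namespace LieStages

universe u v w z

/-- `N` carries the manifold structure of an embedded Lie subgroup of `G`. -/
class IsEmbeddedLieSubgroup (E : Type u) (EN : Type v) {G : Type w}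
    [NormedAddCommGroup E] [NormedSpace ℝ E] [NormedAddCommGroup EN] [NormedSpace ℝ EN]
    [TopologicalSpace G] [Group G] [ChartedSpace E G]
    (N : Subgroup G) [ChartedSpace EN N] : Prop where
  isSmoothEmbedding : IsSmoothEmbedding 𝓘(ℝ, EN) 𝓘(ℝ, E) ∞ (Subtype.val : N → G)

section Adjoint

variable {E : Type u} {EN : Type v} {G : Type w}
  [NormedAddCommGroup E] [NormedSpace ℝ E] [NormedAddCommGroup EN] [NormedSpace ℝ EN]
  [TopologicalSpace G] [Group G] [ChartedSpace E G] [LieGroup 𝓘(ℝ, E) ∞ G]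
  (N : Subgroup G) [N.Normal] [ChartedSpace EN N]

variable (EN) in
/-- `Ad_g : 𝔫 → 𝔫`, the derivative at `e` of the conjugation `n ↦ g n g⁻¹` of `N`. -/
def lieAd (g : G) : GroupLieAlgebra 𝓘(ℝ, EN) N →L[ℝ] GroupLieAlgebra 𝓘(ℝ, EN) N :=
  mfderiv 𝓘(ℝ, EN) 𝓘(ℝ, EN) (fun n : N => MulAut.conjNormal g n) (1 : N)

variable {N}

lemma contMDiff_conj (hN : IsEmbeddedLieSubgroup E EN N) (g : G) :
    ContMDiff 𝓘(ℝ, EN) 𝓘(ℝ, EN) ∞ (fun n : N => MulAut.conjNormal g n) := by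
  have hι := hN.isSmoothEmbedding
  have h2 : ContMDiff 𝓘(ℝ, EN) 𝓘(ℝ, E) ∞ (fun n : N => g * (n : G) * g⁻¹) :=
    (contMDiff_const.mul hι.contMDiff).mul contMDiff_const
  have h1 : (Subtype.val ∘ fun n : N => MulAut.conjNormal g n) =
      fun n : N => g * (n : G) * g⁻¹ := by
    funext n
    simp [MulAut.conjNormal_apply]
  rw [ContMDiff.iff_comp_isImmersion hι.isImmersion, h1]
  refine ⟨?_, h2⟩
  rw [hι.isEmbedding.continuous_iff, h1]
  exact h2.continuous

lemma lieAd_one : lieAd EN N (1 : G) = ContinuousLinearMap.id ℝ _ := by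
  have h : (fun n : N => MulAut.conjNormal (1 : G) n) = id := by
    funext n
    simp
  unfold lieAd
  rw [h]
  exact mfderiv_id

lemma lieAd_mul (hN : IsEmbeddedLieSubgroup E EN N) (g h : G)
    (η : GroupLieAlgebra 𝓘(ℝ, EN) N) :
    lieAd EN N (g * h) η = lieAd EN N g (lieAd EN N h η) := by
  have e : (fun n : N => MulAut.conjNormal (g * h) n) =
      (fun n : N => MulAut.conjNormal g n) ∘ (fun n : N => MulAut.conjNormal h n) := by
    funext n
    simp
  have hd : ∀ (k : G) (n : N), MDifferentiableAt 𝓘(ℝ, EN) 𝓘(ℝ, EN)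
      (fun n : N => MulAut.conjNormal k n) n := fun k n =>
    (contMDiff_conj hN k).mdifferentiable (by simp) n
  have h1 : MulAut.conjNormal h (1 : N) = 1 := map_one _
  have := mfderiv_comp (I := 𝓘(ℝ, EN)) (I' := 𝓘(ℝ, EN)) (I'' := 𝓘(ℝ, EN)) (1 : N)
    (hd g (MulAut.conjNormal h (1 : N))) (hd h 1)
  have h2 : ∀ n : N, n = 1 → (mfderiv 𝓘(ℝ, EN) 𝓘(ℝ, EN) (fun n : N => MulAut.conjNormal g n) n :
      EN →L[ℝ] EN) = mfderiv 𝓘(ℝ, EN) 𝓘(ℝ, EN) (fun n : N => MulAut.conjNormal g n) (1 : N) := by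
    rintro n rfl
    rfl
  have h3 := h2 _ h1
  unfold lieAd
  rw [e, this]
  exact congrArg (fun L : EN →L[ℝ] EN => L (lieAd EN N h η)) h3

variable (E EN N) [hN : IsEmbeddedLieSubgroup E EN N]

/-- The relation `(g, η) ∼ (n g, Ad_n η)`, `n ∈ N`, on `G × 𝔫`. -/
def adjSetoid : Setoid (G × GroupLieAlgebra 𝓘(ℝ, EN) N) where
  r p q := ∃ n : N, q = ((n : G) * p.1, lieAd EN N (n : G) p.2)
  iseqv := by
    refine ⟨fun p => ⟨1, by simp [lieAd_one]⟩, ?_, ?_⟩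
    · rintro p q ⟨n, rfl⟩
      refine ⟨n⁻¹, ?_⟩
      simp [← lieAd_mul hN, lieAd_one]
    · rintro p q r ⟨n, rfl⟩ ⟨m, rfl⟩
      exact ⟨m * n, by simp [← lieAd_mul hN, mul_assoc]⟩

/-- The adjoint bundle `ñ = (G × 𝔫) / N` of the left principal `N`-bundle `G → G ⧸ N`. -/
def AdjBundle : Type (max v w) := Quotient (adjSetoid E EN N)

variable {N}

/-- The class `[g, η]_N`. -/
def adjMk (g : G) (η : GroupLieAlgebra 𝓘(ℝ, EN) N) : AdjBundle E EN N :=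
  Quotient.mk (adjSetoid E EN N) (g, η)

lemma adjMk_eq_iff {g h : G} {η ξ : GroupLieAlgebra 𝓘(ℝ, EN) N} :
    adjMk E EN g η = adjMk E EN h ξ ↔
      ∃ n : N, h = n * g ∧ ξ = lieAd EN N (n : G) η := by
  have h1 : adjMk E EN g η = adjMk E EN h ξ ↔
      ∃ n : N, (h, ξ) = ((n : G) * g, lieAd EN N (n : G) η) :=
    Quotient.eq (r := adjSetoid E EN N)
  rw [h1]
  exact exists_congr fun n => Prod.ext_iff

lemma mk_coe_mul (n : N) (g : G) : ((n * g : G) : G ⧸ N) = g := by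
  rw [QuotientGroup.mk_mul, (QuotientGroup.eq_one_iff (n : G)).2 n.2, one_mul]

/-- The projection `ñ → G ⧸ N`, `[g, η]_N ↦ [g]_N`. -/
def adjProj : AdjBundle E EN N → G ⧸ N :=
  Quotient.lift (fun p => (p.1 : G ⧸ N)) (by
    rintro p q ⟨n, rfl⟩
    exact (mk_coe_mul n p.1).symm)

@[simp] lemma adjProj_mk (g : G) (η : GroupLieAlgebra 𝓘(ℝ, EN) N) :
    adjProj E EN (adjMk E EN g η) = g := rfl

/-- The fiber of `ñ` over `k`. -/
def AdjFiber (k : G ⧸ N) : Type (max v w) := {z : AdjBundle E EN N // adjProj E EN z = k}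

/-- `[g, η]_N` as an element of the fiber of `ñ` over `[g]_N`. -/
def fiberMk (g : G) (η : GroupLieAlgebra 𝓘(ℝ, EN) N) : AdjFiber E EN (g : G ⧸ N) :=
  ⟨adjMk E EN g η, rfl⟩

/-- For `g` over `k`, the map `η ↦ [g, η]_N` is a bijection of `𝔫` onto the fiber over `k`. -/
lemma bijective_adjMk (k : G ⧸ N) (g : G) (hg : (g : G ⧸ N) = k) :
    Function.Bijective
      (fun η : GroupLieAlgebra 𝓘(ℝ, EN) N => (⟨adjMk E EN g η, hg⟩ : AdjFiber E EN k)) := by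
  subst hg
  constructor
  · intro η ξ h
    obtain ⟨n, h1, h2⟩ := (adjMk_eq_iff E EN).1 (congrArg Subtype.val h)
    have : (n : G) = 1 := by simpa using h1.symm
    rw [this, lieAd_one] at h2
    exact h2.symm
  · rintro ⟨z, hz⟩
    induction z using Quotient.inductionOn with
    | _ p =>
    obtain ⟨h, ξ⟩ := p
    have h1 : (h : G ⧸ N) = g := hz
    have h2 : g * h⁻¹ ∈ N := by
      rw [← QuotientGroup.eq_one_iff, QuotientGroup.mk_mul, QuotientGroup.mk_inv, h1,
        mul_inv_cancel]
    refine ⟨lieAd EN N (g * h⁻¹) ξ, Subtype.ext ?_⟩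
    exact ((adjMk_eq_iff E EN).2 ⟨⟨_, h2⟩, by simp, rfl⟩).symm

/-- The linear coordinate on the fiber over `k` attached to the chosen `k.out` over `k`. By
`fiberMk_add`, `fiberMk_smul` and `isHomeomorph_fiberMk`, the vector space structure and the topology
that it induces on the fiber do not depend on this choice. -/
def fiberCoord (k : G ⧸ N) : AdjFiber E EN k ≃ GroupLieAlgebra 𝓘(ℝ, EN) N :=
  (Equiv.ofBijective _ (bijective_adjMk E EN k k.out (QuotientGroup.out_eq' k))).symm

instance (k : G ⧸ N) : AddCommGroup (AdjFiber E EN k) := (fiberCoord E EN k).addCommGroup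

instance (k : G ⧸ N) : Module ℝ (AdjFiber E EN k) := (fiberCoord E EN k).module ℝ

instance (k : G ⧸ N) : TopologicalSpace (AdjFiber E EN k) :=
  TopologicalSpace.induced (fiberCoord E EN k) inferInstance

lemma exists_fiberCoord_fiberMk (g : G) : ∃ n : N, ∀ η : GroupLieAlgebra 𝓘(ℝ, EN) N,
    fiberCoord E EN (g : G ⧸ N) (fiberMk E EN g η) = lieAd EN N (n : G) η := by
  have h2 : (g : G ⧸ N).out * g⁻¹ ∈ N := by
    rw [← QuotientGroup.eq_one_iff, QuotientGroup.mk_mul, QuotientGroup.mk_inv,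
      QuotientGroup.out_eq', mul_inv_cancel]
  refine ⟨⟨_, h2⟩, fun η => ?_⟩
  refine (Equiv.symm_apply_eq _).2 (Subtype.ext ?_)
  exact (adjMk_eq_iff E EN).2 ⟨⟨_, h2⟩, by simp, rfl⟩

/-- `[g, η]_N + [g, ξ]_N = [g, η + ξ]_N`. -/
lemma fiberMk_add (g : G) (η ξ : GroupLieAlgebra 𝓘(ℝ, EN) N) :
    fiberMk E EN g (η + ξ) = fiberMk E EN g η + fiberMk E EN g ξ := by
  obtain ⟨n, hn⟩ := exists_fiberCoord_fiberMk E EN (N := N) g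
  apply (fiberCoord E EN (g : G ⧸ N)).injective
  rw [Equiv.add_def, Equiv.apply_symm_apply, hn, hn, hn, map_add]

/-- `c [g, η]_N = [g, c η]_N`. -/
lemma fiberMk_smul (g : G) (c : ℝ) (η : GroupLieAlgebra 𝓘(ℝ, EN) N) :
    fiberMk E EN g (c • η) = c • fiberMk E EN g η := by
  obtain ⟨n, hn⟩ := exists_fiberCoord_fiberMk E EN (N := N) g
  apply (fiberCoord E EN (g : G ⧸ N)).injective
  rw [Equiv.smul_def, Equiv.apply_symm_apply, hn, hn, map_smul]

/-- `η ↦ [g, η]_N` is a homeomorphism of `𝔫` onto the fiber over `[g]_N`. -/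
lemma isHomeomorph_fiberMk (g : G) : IsHomeomorph (fiberMk E EN (N := N) g) := by
  obtain ⟨n, hn⟩ := exists_fiberCoord_fiberMk E EN (N := N) g
  have hb : Function.Bijective (fiberMk E EN (N := N) g) := bijective_adjMk E EN _ g rfl
  have hc : IsInducing (fiberCoord E EN (g : G ⧸ N)) := ⟨rfl⟩
  rw [isHomeomorph_iff_isEmbedding_surjective]
  refine ⟨⟨?_, hb.1⟩, hb.2⟩
  have h1 : fiberCoord E EN (g : G ⧸ N) ∘ fiberMk E EN g = lieAd EN N (n : G) := funext hn
  have h2 : Function.LeftInverse (lieAd EN N ((n : G)⁻¹)) (lieAd EN N (n : G)) := fun η => by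
    rw [← lieAd_mul hN, inv_mul_cancel, lieAd_one]
    rfl
  have h3 : IsInducing (fiberCoord E EN (g : G ⧸ N) ∘ fiberMk E EN g) := by
    rw [h1]
    exact (h2.isEmbedding (lieAd EN N ((n : G)⁻¹)).continuous
      (lieAd EN N (n : G)).continuous).isInducing
  exact hc.of_comp_iff.1 h3

/-- The action `[g]_N · [h, η]_N = [g h, Ad_g η]_N` of `K = G ⧸ N` on `ñ`. -/
instance : MulAction (G ⧸ N) (AdjBundle E EN N) where
  smul k z := Quotient.lift₂ (s₁ := QuotientGroup.leftRel N) (s₂ := adjSetoid E EN N)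
    (fun g p => adjMk E EN (g * p.1) (lieAd EN N g p.2)) (by
      rintro a p b q hab ⟨n, rfl⟩
      have h1 : a⁻¹ * b ∈ N := QuotientGroup.leftRel_apply.1 hab
      have h2 : b * n * a⁻¹ ∈ N := by
        have := (inferInstance : N.Normal).conj_mem _ (N.mul_mem h1 n.2) a
        simpa [mul_assoc] using this
      refine (adjMk_eq_iff E EN).2 ⟨⟨_, h2⟩, ?_, ?_⟩
      · simp [mul_assoc]
      · simp [← lieAd_mul hN]) k z
  one_smul z := by
    induction z using Quotient.inductionOn with
    | _ p => exact (adjMk_eq_iff E EN).2 ⟨1, by simp, by simp [lieAd_one]⟩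
  mul_smul k l z := by
    induction z using Quotient.inductionOn with
    | _ p =>
    induction k using QuotientGroup.induction_on with
    | H g =>
    induction l using QuotientGroup.induction_on with
    | H h =>
    refine (adjMk_eq_iff E EN).2 ⟨1, ?_, ?_⟩
    · simp [mul_assoc]
    · simp [lieAd_one, lieAd_mul hN]

lemma coe_smul_adjMk (g h : G) (η : GroupLieAlgebra 𝓘(ℝ, EN) N) :
    (g : G ⧸ N) • adjMk E EN h η = adjMk E EN (g * h) (lieAd EN N g η) := rfl

lemma adjProj_smul (k : G ⧸ N) (z : AdjBundle E EN N) :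
    adjProj E EN (k • z) = k * adjProj E EN z := by
  induction z using Quotient.inductionOn with
  | _ p =>
  induction k using QuotientGroup.induction_on with
  | H g => exact QuotientGroup.mk_mul N g p.1

/-- The section `σ_η([g]_N) = [g, Ad_g η]_N` of `ñ`. -/
def invSection (η : GroupLieAlgebra 𝓘(ℝ, EN) N) (k : G ⧸ N) : AdjFiber E EN k :=
  ⟨Quotient.lift (s := QuotientGroup.leftRel N) (fun g => adjMk E EN g (lieAd EN N g η)) (by
    intro a b hab
    have h1 : a⁻¹ * b ∈ N := QuotientGroup.leftRel_apply.1 hab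
    have h2 : b * a⁻¹ ∈ N := by
      simpa [mul_assoc] using (inferInstance : N.Normal).conj_mem _ h1 a
    exact (adjMk_eq_iff E EN).2 ⟨⟨_, h2⟩, by simp, by simp [← lieAd_mul hN]⟩) k, by
    induction k using QuotientGroup.induction_on with
    | H g => rfl⟩

/-- `σ_η` is `K`-invariant. -/
lemma smul_invSection (η : GroupLieAlgebra 𝓘(ℝ, EN) N) (k l : G ⧸ N) :
    k • (invSection E EN η l).1 = (invSection E EN η (k * l)).1 := by
  induction k using QuotientGroup.induction_on with
  | H g =>
  induction l using QuotientGroup.induction_on with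
  | H h =>
  change adjMk E EN (g * h) _ = adjMk E EN (g * h) _
  rw [lieAd_mul hN]

variable (N) in
/-- The quotient `ñ / K`, a bundle over the single point `K / K`. -/
abbrev AdjQuotient : Type (max v w) := MulAction.orbitRel.Quotient (G ⧸ N) (AdjBundle E EN N)

/-- The class `[z]_K` of `z ∈ ñ`. -/
def classK (z : AdjBundle E EN N) : AdjQuotient E EN N :=
  Quotient.mk (MulAction.orbitRel (G ⧸ N) (AdjBundle E EN N)) z

lemma classK_eq_iff {y z : AdjBundle E EN N} :
    classK E EN y = classK E EN z ↔ ∃ k : G ⧸ N, k • z = y :=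
  Quotient.eq (r := MulAction.orbitRel (G ⧸ N) (AdjBundle E EN N))

/-- The natural identification `𝔫 ≡ ñ / K`, `η ≡ [[e, η]_N]_K`. -/
def quotientIdent : GroupLieAlgebra 𝓘(ℝ, EN) N ≃ AdjQuotient E EN N :=
  Equiv.ofBijective (fun η => classK E EN (adjMk E EN 1 η)) (by
    constructor
    · intro η ξ h
      obtain ⟨k, hk⟩ := (classK_eq_iff E EN).1 h
      have h1 : k = 1 := by
        have := congrArg (adjProj E EN) hk
        rwa [adjProj_smul, adjProj_mk, adjProj_mk, QuotientGroup.mk_one, mul_one] at this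
      rw [h1, one_smul] at hk
      exact (bijective_adjMk E EN (1 : G ⧸ N) 1 rfl).1 (Subtype.ext hk.symm)
    · intro y
      induction y using Quotient.inductionOn with
      | _ z =>
      induction z using Quotient.inductionOn with
      | _ p =>
      obtain ⟨g, ξ⟩ := p
      refine ⟨lieAd EN N g⁻¹ ξ, (classK_eq_iff E EN).2 ⟨(g⁻¹ : G), ?_⟩⟩
      change (_ : G ⧸ N) • adjMk E EN g ξ = _
      rw [coe_smul_adjMk, inv_mul_cancel])

/-- `η ≡ [σ_η]_K`. -/
lemma quotientIdent_eq (η : GroupLieAlgebra 𝓘(ℝ, EN) N) (k : G ⧸ N) :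
    quotientIdent E EN η = classK E EN (invSection E EN η k).1 := by
  induction k using QuotientGroup.induction_on with
  | H g =>
  refine (classK_eq_iff E EN).2 ⟨(g⁻¹ : G), ?_⟩
  change (_ : G ⧸ N) • adjMk E EN g (lieAd EN N g η) = _
  rw [coe_smul_adjMk, ← lieAd_mul hN, inv_mul_cancel, lieAd_one]
  rfl

end Adjoint

section Connection

variable {E : Type u} {EN : Type v} {EK : Type z} {G : Type w}
  [NormedAddCommGroup E] [NormedSpace ℝ E] [NormedAddCommGroup EN] [NormedSpace ℝ EN]
  [NormedAddCommGroup EK] [NormedSpace ℝ EK]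
  [TopologicalSpace G] [Group G] [ChartedSpace E G]

variable (E G) in
/-- Smooth Riemannian metrics on `G`. -/
abbrev Metric [IsManifold 𝓘(ℝ, E) ∞ G] : Type (max u w) :=
  Bundle.ContMDiffRiemannianMetric 𝓘(ℝ, E) ∞ E (fun g : G => TangentSpace 𝓘(ℝ, E) g)

variable [LieGroup 𝓘(ℝ, E) ∞ G]

/-- Invariance of the metric under the left translations of `G`. -/
def IsInvariantMetric (μ : Metric E G) : Prop :=
  ∀ (g h : G) (v w : TangentSpace 𝓘(ℝ, E) h),
    μ.inner (g * h) (mfderiv 𝓘(ℝ, E) 𝓘(ℝ, E) (fun x : G => g * x) h v)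
      (mfderiv 𝓘(ℝ, E) 𝓘(ℝ, E) (fun x : G => g * x) h w) = μ.inner h v w

variable {N : Subgroup G} [ChartedSpace EN N]

variable (E EN N) in
/-- The infinitesimal generator `η ↦ η g ∈ T_g G` of the left action of `N` on `G`. -/
def vertGen (g : G) : GroupLieAlgebra 𝓘(ℝ, EN) N →L[ℝ] TangentSpace 𝓘(ℝ, E) g :=
  mfderiv 𝓘(ℝ, EN) 𝓘(ℝ, E) (fun n : N => (n : G) * g) (1 : N)

variable (E EN N) in
/-- The inclusion `𝔫 → 𝔤`, the derivative at `e` of `N → G`. -/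
def inclLie : GroupLieAlgebra 𝓘(ℝ, EN) N →L[ℝ] GroupLieAlgebra 𝓘(ℝ, E) G :=
  mfderiv 𝓘(ℝ, EN) 𝓘(ℝ, E) (Subtype.val : N → G) (1 : N)

variable (EN N) in
/-- The horizontal space `H_N(g)`: the orthogonal complement in `T_g G` of the vertical space, the
tangent space `{η g : η ∈ 𝔫}` of the `N`-orbit of `g`. -/
def horizontal (μ : Metric E G) (g : G) : Submodule ℝ (TangentSpace 𝓘(ℝ, E) g) where
  carrier := {v | ∀ η, μ.inner g v (vertGen E EN N g η) = 0}
  zero_mem' η := by simp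
  add_mem' hv hw η := by simp [hv η, hw η]
  smul_mem' c v hv η := by simp [hv η]

variable (EN N) in
/-- The connection form `A_N` at `g`: `A_N(v)` is the element `η` of `𝔫` whose generator `η g` is
the vertical part of `v`. -/
def connForm (μ : Metric E G) (g : G) (v : TangentSpace 𝓘(ℝ, E) g) :
    GroupLieAlgebra 𝓘(ℝ, EN) N :=
  Classical.epsilon fun η => v - vertGen E EN N g η ∈ horizontal EN N μ g

variable [N.Normal] [ChartedSpace EK (G ⧸ N)]

variable (E EK N) in
/-- The derivative `𝔤 → 𝔨` at `e` of the projection `G → K = G ⧸ N`. -/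
def projLie : GroupLieAlgebra 𝓘(ℝ, E) G →L[ℝ] GroupLieAlgebra 𝓘(ℝ, EK) (G ⧸ N) :=
  mfderiv 𝓘(ℝ, E) 𝓘(ℝ, EK) (fun g : G => (g : G ⧸ N)) (1 : G)

variable (EN) in
/-- The horizontal lift `κ^{A_N} ∈ 𝔤` of `κ ∈ 𝔨` at the neutral element. -/
def horLift (μ : Metric E G) (κ : GroupLieAlgebra 𝓘(ℝ, EK) (G ⧸ N)) :
    GroupLieAlgebra 𝓘(ℝ, E) G :=
  Classical.epsilon fun v => v ∈ horizontal EN N μ 1 ∧ projLie E EK N v = κ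

/-- The velocity at `t` of a curve in a manifold. -/
def velocity {F : Type*} [NormedAddCommGroup F] [NormedSpace ℝ F] {M : Type*} [TopologicalSpace M]
    [ChartedSpace F M] (x : ℝ → M) (t : ℝ) : TangentSpace 𝓘(ℝ, F) (x t) :=
  mfderiv 𝓘(ℝ, ℝ) 𝓘(ℝ, F) x t (1 : ℝ)

variable (EN) in
/-- `q` is a horizontal lift, along the interval with end points `a` and `b`, of the curve `x`. -/
def IsHorizontalLift (μ : Metric E G) (x : ℝ → G ⧸ N) (a b : ℝ) (q : ℝ → G) : Prop :=
  ∀ t ∈ Set.uIcc a b, ContMDiffAt 𝓘(ℝ, ℝ) 𝓘(ℝ, E) 1 q t ∧ (q t : G ⧸ N) = x t ∧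
    velocity q t ∈ horizontal EN N μ (q t)

variable [IsEmbeddedLieSubgroup E EN N]

/-- `y` is the parallel transport of `z` along the curve `x` from time `a` to time `b`:
`z = [q(a), m]_N` and `y = [q(b), m]_N`, with `q` a horizontal lift of `x`. -/
def IsParallelTransport (μ : Metric E G) (x : ℝ → G ⧸ N) (a b : ℝ)
    (z : AdjFiber E EN (x a)) (y : AdjFiber E EN (x b)) : Prop :=
  ∃ (q : ℝ → G) (m : GroupLieAlgebra 𝓘(ℝ, EN) N), IsHorizontalLift EN μ x a b q ∧
    z.1 = adjMk E EN (q a) m ∧ y.1 = adjMk E EN (q b) m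

/-- The curve `c` in `ñ` over the curve `x` in `K` has covariant derivative `w` at time `t`:
`w = lim_{s → 0} (τ^{t+s}_t c(t+s) - c(t)) / s`, with `τ` the parallel transport along `x`. -/
def HasCovDerivAt (μ : Metric E G) (x : ℝ → G ⧸ N) (c : ∀ t, AdjFiber E EN (x t)) (t : ℝ)
    (w : AdjFiber E EN (x t)) : Prop :=
  ∃ T : ℝ → AdjFiber E EN (x t),
    (∀ᶠ s in 𝓝 (0 : ℝ), IsParallelTransport μ x (t + s) t (c (t + s)) (T s)) ∧
    Tendsto (fun s : ℝ => s⁻¹ • (T s - c t)) (𝓝[≠] 0) (𝓝 w)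

/-- `∇_X v = w` for the affine connection `∇` of `ñ` induced by `A_N`: the covariant derivative of
`v` along any smooth curve with velocity `X` at time `t` is `w`, at every point. -/
def IsNabla (μ : Metric E G) (X : ∀ k : G ⧸ N, TangentSpace 𝓘(ℝ, EK) k)
    (v w : ∀ k : G ⧸ N, AdjFiber E EN k) : Prop :=
  ∀ (x : ℝ → G ⧸ N) (t : ℝ), ContMDiff 𝓘(ℝ, ℝ) 𝓘(ℝ, EK) ∞ x → velocity x t = X (x t) →
    HasCovDerivAt μ x (fun s => v (x s)) t (w (x t))

/-- `y ∈ ñ / K` is the reduced vertical covariant derivative in the direction `κ ∈ 𝔨` of the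
`K`-invariant section `v` of `ñ`: `y` is the class of the section `∇_{X₀} v`, where `X₀` is the
invariant vector field on `K` with `X₀(e) = κ`. Every vector field on `K` is vertical for the
principal bundle `K → {e}` with structure group `K`, and the principal connection of that bundle
takes the value `κ` on `X₀(e)`. -/
def IsReducedVertDeriv (μ : Metric E G) (κ : GroupLieAlgebra 𝓘(ℝ, EK) (G ⧸ N))
    (v : ∀ k : G ⧸ N, AdjFiber E EN k) (y : AdjQuotient E EN N) : Prop :=
  ∃ w : ∀ k : G ⧸ N, AdjFiber E EN k,
    IsNabla μ (mulInvariantVectorField (I := 𝓘(ℝ, EK)) κ) v w ∧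
    (∀ k l : G ⧸ N, k • (w l).1 = (w (k * l)).1) ∧ ∀ k : G ⧸ N, classK E EN (w k).1 = y

variable (EN) in
/-- `a_N(κ, κ') = -A_N([κ^{A_N}, κ'^{A_N}])`. -/
def aForm (μ : Metric E G) (κ κ' : GroupLieAlgebra 𝓘(ℝ, EK) (G ⧸ N)) :
    GroupLieAlgebra 𝓘(ℝ, EN) N :=
  -connForm EN N μ 1 ⁅horLift EN μ κ, horLift EN μ κ'⁆

/-- `b_N(κ, η) = [κ^{A_N}, η] ∈ 𝔫`, the element of `𝔫` with this image in `𝔤`. -/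
def bForm (μ : Metric E G) (κ : GroupLieAlgebra 𝓘(ℝ, EK) (G ⧸ N))
    (η : GroupLieAlgebra 𝓘(ℝ, EN) N) : GroupLieAlgebra 𝓘(ℝ, EN) N :=
  Classical.epsilon fun ξ => inclLie E EN N ξ = ⁅horLift EN μ κ, inclLie E EN N η⁆

end Connection

end LieStages

end

/-! The proof rests on two facts: the derivative of `Ad` is the bracket, and the horizontal
distribution is left invariant.

For the first, let `m` be the multiplication in a chart at `e`. Differentiating the identity (y z
y⁻¹) y = y z in z at e relates `Ad_y` to the partial derivatives of `m`. Differentiating again in y,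
and using the symmetry of the second derivative of `m`, gives the bracket of left-invariant fields
(`hasFDerivAt_chartConj`, `HasVelocityAtOne.hasDerivAt_conj`). Since homomorphisms commute with
conjugation, their derivatives preserve brackets (`tderiv_modelBracket`). This applies to N → G and
to G → K. The kernel of 𝔤 → 𝔨 is 𝔫 (`modelProj_modelIncl`, `exists_modelIncl_eq`), so [κ^A, η] ∈ 𝔫
and the splitting 𝔤 = 𝔨 ⊕ 𝔫 follows. The bracket formula is then a bilinear expansion, in which
[κ^A, κ'^A] has horizontal part [κ, κ']^A.

For the second, η g = g Ad_{g⁻¹} η, so the vertical space at g is the left translate of 𝔫, and left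
invariance of the metric gives H(g) = g H(e) (`leftD_mem_modelHorizontal`). A lift q of x is
therefore horizontal exactly when q⁻¹q' is the horizontal lift of x⁻¹x'. This equation has local
solutions (`exists_horizontal_lift`), and two of them over the same interval differ by a constant of
N (`IsHorizontalLift.exists_eq_mul`), so parallel transport is single-valued. Along q one has
σ_η(x(s)) = [q(s), Ad_{q(s)} η], and transport back to time t gives [q(t), Ad_{q(s)} η]. If x has
velocity x(t) κ at time t, the derivative there is [q(t), Ad_{q(t)} [κ^A, η]], which is the value of
σ at [κ^A, η]. -/

noncomputable section

namespace LieStages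

universe u v w z

/-! ### Derivatives of maps of manifolds, read in the model spaces -/

section TangentMap

variable {F F' F'' : Type*} [NormedAddCommGroup F] [NormedSpace ℝ F]
  [NormedAddCommGroup F'] [NormedSpace ℝ F'] [NormedAddCommGroup F''] [NormedSpace ℝ F'']
  {M M' M'' : Type*} [TopologicalSpace M] [ChartedSpace F M]
  [TopologicalSpace M'] [ChartedSpace F' M'] [TopologicalSpace M''] [ChartedSpace F'' M'']

variable (F F') in
/-- The derivative of a map of manifolds at a point, as a map of the model spaces. -/
def tderiv (h : M → M') (p : M) : F →L[ℝ] F' := mfderiv 𝓘(ℝ, F) 𝓘(ℝ, F') h p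

lemma tderiv_comp {g : M' → M''} {f : M → M'} {x : M} {y : M'} (hy : f x = y)
    (hg : MDifferentiableAt 𝓘(ℝ, F') 𝓘(ℝ, F'') g y)
    (hf : MDifferentiableAt 𝓘(ℝ, F) 𝓘(ℝ, F') f x) :
    tderiv F F'' (g ∘ f) x = (tderiv F' F'' g y).comp (tderiv F F' f x) := by
  subst hy
  exact mfderiv_comp x hg hf

lemma tderiv_comp_apply {g : M' → M''} {f : M → M'} {x : M} {y : M'} (hy : f x = y)
    (hg : MDifferentiableAt 𝓘(ℝ, F') 𝓘(ℝ, F'') g y)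
    (hf : MDifferentiableAt 𝓘(ℝ, F) 𝓘(ℝ, F') f x) (v : F) :
    tderiv F F'' (g ∘ f) x v = tderiv F' F'' g y (tderiv F F' f x v) := by
  rw [tderiv_comp hy hg hf]; rfl

lemma tderiv_id (x : M) : tderiv F F (id : M → M) x = ContinuousLinearMap.id ℝ F := mfderiv_id

lemma tderiv_const (c : M') (x : M) : tderiv F F' (fun _ : M => c) x = 0 := mfderiv_const

lemma tderiv_congr {f g : M → M'} {x : M} (h : f =ᶠ[𝓝 x] g) :
    tderiv F F' f x = tderiv F F' g x := by
  have h1 := h.mfderiv_eq (I := 𝓘(ℝ, F)) (I' := 𝓘(ℝ, F'))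
  exact h1

lemma tderiv_eq_fderiv (f : F → F') (x : F) : tderiv F F' f x = fderiv ℝ f x := mfderiv_eq_fderiv

variable [IsManifold 𝓘(ℝ, F) 1 M]

/-- The chart at x is the one that identifies the tangent space at x with the model space. -/
lemma tderiv_extChartAt (x : M) :
    tderiv F F (extChartAt 𝓘(ℝ, F) x) x = ContinuousLinearMap.id ℝ F := by
  ext v
  have h1 : tderiv F F (extChartAt 𝓘(ℝ, F) x) x = tangentCoordChange 𝓘(ℝ, F) x x x :=
    mfderiv_chartAt_eq_tangentCoordChange (I := 𝓘(ℝ, F)) (mem_chart_source F x)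
  rw [h1]
  exact tangentCoordChange_self (mem_extChartAt_source x)

lemma mdifferentiableAt_extChartAt_symm {x : M} {y : F} (hy : y ∈ (extChartAt 𝓘(ℝ, F) x).target) :
    MDifferentiableAt 𝓘(ℝ, F) 𝓘(ℝ, F) (extChartAt 𝓘(ℝ, F) x).symm y := by
  have := mdifferentiableWithinAt_extChartAt_symm (I := 𝓘(ℝ, F)) hy
  rwa [ModelWithCorners.range_eq_univ, mdifferentiableWithinAt_univ] at this

lemma tderiv_extChartAt_symm (x : M) :
    tderiv F F (extChartAt 𝓘(ℝ, F) x).symm (extChartAt 𝓘(ℝ, F) x x) =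
      ContinuousLinearMap.id ℝ F := by
  have h := tderiv_comp (F := F) (F' := F) (F'' := F) (f := (extChartAt 𝓘(ℝ, F) x).symm)
    (g := extChartAt 𝓘(ℝ, F) x) (x := extChartAt 𝓘(ℝ, F) x x) (y := x)
    (extChartAt_to_inv x) (mdifferentiableAt_extChartAt (mem_chart_source F x))
    (mdifferentiableAt_extChartAt_symm (mem_extChartAt_target x))
  rw [tderiv_extChartAt, ContinuousLinearMap.id_comp] at h
  rw [← h, ← tderiv_id (F := F) (extChartAt 𝓘(ℝ, F) x x)]
  apply tderiv_congr
  filter_upwards [extChartAt_target_mem_nhds (I := 𝓘(ℝ, F)) x] with z hz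
  exact (extChartAt 𝓘(ℝ, F) x).right_inv hz

end TangentMap

/-! ### Smoothness through charts -/

section Chart

variable {E F : Type*} [NormedAddCommGroup E] [NormedSpace ℝ E] [NormedAddCommGroup F]
  [NormedSpace ℝ F] {G : Type*} [TopologicalSpace G] [ChartedSpace E G] {n : ℕ∞ω}
  [IsManifold 𝓘(ℝ, E) n G]

lemma contDiffAt_extChartAt_comp {A : F → G} {x : F} {p : G}
    (hA : ContMDiffAt 𝓘(ℝ, F) 𝓘(ℝ, E) n A x) (hx : A x ∈ (extChartAt 𝓘(ℝ, E) p).source) :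
    ContDiffAt ℝ n (fun z => extChartAt 𝓘(ℝ, E) p (A z)) x := by
  rw [← contMDiffAt_iff_contDiffAt]
  exact ContMDiffAt.comp x (contMDiffAt_extChartAt' (by rwa [extChartAt_source] at hx)) hA

lemma contMDiffAt_extChartAt_symm_comp {a : F → E} {x : F} {p : G}
    (ha : ContDiffAt ℝ n a x) (hx : a x ∈ (extChartAt 𝓘(ℝ, E) p).target) :
    ContMDiffAt 𝓘(ℝ, F) 𝓘(ℝ, E) n (fun z => (extChartAt 𝓘(ℝ, E) p).symm (a z)) x :=
  ContMDiffAt.comp x ((contMDiffOn_extChartAt_symm p).contMDiffAt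
    ((isOpen_extChartAt_target p).mem_nhds hx)) ha.contMDiffAt

end Chart

/-! ### Multiplication, conjugation and invariant fields in the chart at the neutral element -/

section LieGroupCalculus

variable {E : Type*} [NormedAddCommGroup E] [NormedSpace ℝ E]
  {G : Type*} [TopologicalSpace G] [Group G] [ChartedSpace E G] [LieGroup 𝓘(ℝ, E) ∞ G]

variable (E G) in
/-- The chart at the neutral element. -/
abbrev oneChart : PartialEquiv G E := extChartAt 𝓘(ℝ, E) (1 : G)

variable (E G) in
/-- The multiplication in the chart at the neutral element. -/
def chartMul (y : E × E) : E :=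
  oneChart E G ((oneChart E G).symm y.1 * (oneChart E G).symm y.2)

variable (E G) in
/-- The conjugation in the chart at the neutral element. -/
def chartConj (y : E × E) : E :=
  oneChart E G ((oneChart E G).symm y.1 * (oneChart E G).symm y.2 * ((oneChart E G).symm y.1)⁻¹)

lemma contMDiffAt_symm_fst {y : E × E} (h : y.1 ∈ (oneChart E G).target) :
    ContMDiffAt 𝓘(ℝ, E × E) 𝓘(ℝ, E) ∞ (fun z : E × E => (oneChart E G).symm z.1) y :=
  contMDiffAt_extChartAt_symm_comp contDiffAt_fst h

lemma contMDiffAt_symm_snd {y : E × E} (h : y.2 ∈ (oneChart E G).target) :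
    ContMDiffAt 𝓘(ℝ, E × E) 𝓘(ℝ, E) ∞ (fun z : E × E => (oneChart E G).symm z.2) y :=
  contMDiffAt_extChartAt_symm_comp contDiffAt_snd h

lemma contDiffAt_chartMul {y : E × E} (h1 : y.1 ∈ (oneChart E G).target)
    (h2 : y.2 ∈ (oneChart E G).target)
    (h : (oneChart E G).symm y.1 * (oneChart E G).symm y.2 ∈ (oneChart E G).source) :
    ContDiffAt ℝ ∞ (chartMul E G) y :=
  contDiffAt_extChartAt_comp ((contMDiffAt_symm_fst h1).mul (contMDiffAt_symm_snd h2)) h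

lemma contDiffAt_chartConj {y : E × E} (h1 : y.1 ∈ (oneChart E G).target)
    (h2 : y.2 ∈ (oneChart E G).target)
    (h : (oneChart E G).symm y.1 * (oneChart E G).symm y.2 * ((oneChart E G).symm y.1)⁻¹ ∈
      (oneChart E G).source) :
    ContDiffAt ℝ ∞ (chartConj E G) y :=
  contDiffAt_extChartAt_comp (((contMDiffAt_symm_fst h1).mul (contMDiffAt_symm_snd h2)).mul
    (contMDiffAt_symm_fst h1).inv) h

omit [LieGroup 𝓘(ℝ, E) ∞ G] in
lemma oneChart_symm_one : (oneChart E G).symm (oneChart E G 1) = 1 := extChartAt_to_inv 1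

lemma mdifferentiable_mul_left (g : G) :
    MDifferentiable 𝓘(ℝ, E) 𝓘(ℝ, E) (fun x : G => g * x) :=
  (contMDiff_mul_left (I := 𝓘(ℝ, E)) (n := ∞)).mdifferentiable (by simp)

lemma mdifferentiable_conj (g : G) :
    MDifferentiable 𝓘(ℝ, E) 𝓘(ℝ, E) (fun x : G => g * x * g⁻¹) :=
  (((contMDiff_mul_left (I := 𝓘(ℝ, E)) (n := ∞) (a := g)).mul
    contMDiff_const)).mdifferentiable (by simp)

lemma mdifferentiableAt_oneChart {g : G} (hg : g ∈ (oneChart E G).source) :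
    MDifferentiableAt 𝓘(ℝ, E) 𝓘(ℝ, E) (oneChart E G) g :=
  mdifferentiableAt_extChartAt (by rwa [extChartAt_source] at hg)

/-- The partial derivative of the multiplication at `(y, e)` is the left translation. -/
lemma fderiv_chartMul_snd {y : E} (hy : y ∈ (oneChart E G).target) (v : E) :
    fderiv ℝ (chartMul E G) (y, oneChart E G 1) (0, v) =
      tderiv E E (oneChart E G) ((oneChart E G).symm y)
        (tderiv E E (fun x : G => (oneChart E G).symm y * x) 1 v) := by
  have h1 : (oneChart E G).symm y * (oneChart E G).symm (oneChart E G 1) ∈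
      (oneChart E G).source := by
    rw [oneChart_symm_one, mul_one]
    exact (oneChart E G).map_target hy
  have hd : DifferentiableAt ℝ (chartMul E G) (y, oneChart E G 1) :=
    (contDiffAt_chartMul (y := (y, oneChart E G 1)) hy (mem_extChartAt_target 1) h1).differentiableAt
      (by simp)
  have h2 : fderiv ℝ (chartMul E G) (y, oneChart E G 1) (0, v) =
      fderiv ℝ (fun z => chartMul E G (y, z)) (oneChart E G 1) v := by
    have := fderiv_comp (𝕜 := ℝ) (oneChart E G 1) (g := chartMul E G) (f := fun z => (y, z)) hd
      (by fun_prop)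
    have h3 : fderiv ℝ (fun z : E => (y, z)) (oneChart E G 1) v = (0, v) := by
      rw [(hasFDerivAt_prodMk_right y (oneChart E G 1)).fderiv]
      simp
    rw [← h3]
    exact (congrArg (fun L => L v) this).symm
  rw [h2, ← tderiv_eq_fderiv]
  have e : (fun z => chartMul E G (y, z)) =
      (oneChart E G) ∘ (fun x : G => (oneChart E G).symm y * x) ∘ (oneChart E G).symm := rfl
  have hs := mdifferentiableAt_extChartAt_symm (F := E) (x := (1 : G)) (mem_extChartAt_target 1)
  rw [e, tderiv_comp_apply (y := (oneChart E G).symm y) (by simp)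
    (mdifferentiableAt_oneChart ((oneChart E G).map_target hy))
    (((mdifferentiable_mul_left _) _).comp _ hs),
    tderiv_comp_apply (y := 1) oneChart_symm_one (mdifferentiable_mul_left _ _) hs,
    tderiv_extChartAt_symm]
  rfl

/-- The derivative of the conjugation in the chart. -/
lemma fderiv_chartConj_snd {y : E} (hy : y ∈ (oneChart E G).target) (v : E) :
    fderiv ℝ (chartConj E G) (y, oneChart E G 1) (0, v) =
      tderiv E E (fun x : G => (oneChart E G).symm y * x * ((oneChart E G).symm y)⁻¹) 1 v := by
  have h1 : (oneChart E G).symm y * (oneChart E G).symm (oneChart E G 1) *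
      ((oneChart E G).symm y)⁻¹ ∈ (oneChart E G).source := by
    rw [oneChart_symm_one, mul_one, mul_inv_cancel]
    exact mem_extChartAt_source 1
  have hd : DifferentiableAt ℝ (chartConj E G) (y, oneChart E G 1) :=
    (contDiffAt_chartConj (y := (y, oneChart E G 1)) hy (mem_extChartAt_target 1)
      h1).differentiableAt (by simp)
  have h2 : fderiv ℝ (chartConj E G) (y, oneChart E G 1) (0, v) =
      fderiv ℝ (fun z => chartConj E G (y, z)) (oneChart E G 1) v := by
    have := fderiv_comp (𝕜 := ℝ) (oneChart E G 1) (g := chartConj E G) (f := fun z => (y, z)) hd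
      (by fun_prop)
    have h3 : fderiv ℝ (fun z : E => (y, z)) (oneChart E G 1) v = (0, v) := by
      rw [(hasFDerivAt_prodMk_right y (oneChart E G 1)).fderiv]
      simp
    rw [← h3]
    exact (congrArg (fun L => L v) this).symm
  rw [h2, ← tderiv_eq_fderiv]
  have e : (fun z => chartConj E G (y, z)) = (oneChart E G) ∘
      (fun x : G => (oneChart E G).symm y * x * ((oneChart E G).symm y)⁻¹) ∘
        (oneChart E G).symm := rfl
  have hs := mdifferentiableAt_extChartAt_symm (F := E) (x := (1 : G)) (mem_extChartAt_target 1)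
  -- Conjugation fixes e, so both chart derivatives are taken at e, where they are the identity.
  rw [e, tderiv_comp_apply (y := (1 : G)) (by simp)
    (mdifferentiableAt_oneChart (mem_extChartAt_source 1))
    (((mdifferentiable_conj _) _).comp _ hs),
    tderiv_comp_apply (y := 1) oneChart_symm_one (mdifferentiable_conj _ _) hs,
    tderiv_extChartAt_symm, tderiv_extChartAt]
  rfl

variable (G) in
/-- An invariant vector field in the chart at the neutral element. -/
def chartInvariantField (u y : E) : E :=
  VectorField.mpullbackWithin 𝓘(ℝ, E) 𝓘(ℝ, E) (oneChart E G).symm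
    (mulInvariantVectorField (G := G) (I := 𝓘(ℝ, E)) u) (Set.range 𝓘(ℝ, E)) y

/-- Pulling back by the inverse chart applies the inverse of its derivative, which is the derivative
of the chart. What remains is the left translate of u, read in the chart. -/
lemma chartInvariantField_eq (u : E) {y : E} (hy : y ∈ (oneChart E G).target) :
    chartInvariantField G u y = fderiv ℝ (chartMul E G) (y, oneChart E G 1) (0, u) := by
  have h1 := ContinuousLinearMap.inverse_eq
    (mfderivWithin_extChartAt_symm_comp_mfderiv_extChartAt (I := 𝓘(ℝ, E)) hy)
    (mfderiv_extChartAt_comp_mfderivWithin_extChartAt_symm (I := 𝓘(ℝ, E)) hy)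
  exact (congrArg (fun L => L (mulInvariantVectorField (G := G) (I := 𝓘(ℝ, E)) u
    ((oneChart E G).symm y))) h1).trans (fderiv_chartMul_snd hy u).symm

variable (G) in
/-- The Lie bracket of `𝔤`, on the model space. -/
def modelBracket (v w : E) : E :=
  Bracket.bracket (L := GroupLieAlgebra 𝓘(ℝ, E) G) (M := GroupLieAlgebra 𝓘(ℝ, E) G) v w

/-- The Lie bracket of `𝔤` in the chart at the neutral element. -/
lemma modelBracket_eq_lieBracket_chart (v w : E) :
    modelBracket G v w =
      VectorField.lieBracket ℝ (fun y => fderiv ℝ (chartMul E G) (y, oneChart E G 1) (0, v))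
        (fun y => fderiv ℝ (chartMul E G) (y, oneChart E G 1) (0, w)) (oneChart E G 1) := by
  have hnhds : (oneChart E G).target ∈ 𝓝 (oneChart E G 1) := extChartAt_target_mem_nhds 1
  have h0 : modelBracket G v w =
    (tderiv E E (oneChart E G) (1 : G)).inverse
      (VectorField.lieBracketWithin ℝ (chartInvariantField G v) (chartInvariantField G w)
        ((oneChart E G).symm ⁻¹' Set.univ ∩ Set.range 𝓘(ℝ, E)) (oneChart E G 1)) :=
    VectorField.mlieBracketWithin_apply
  -- The bracket is computed in the chart and carried back by the chart derivative at e, which is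
  -- the identity.
  rw [tderiv_extChartAt, ContinuousLinearMap.inverse_id] at h0
  refine h0.trans ?_
  simp only [Set.preimage_univ, ModelWithCorners.range_eq_univ, Set.inter_univ,
    VectorField.lieBracketWithin_univ]
  refine Filter.EventuallyEq.lieBracket_vectorField_eq ?_ ?_
  · filter_upwards [hnhds] with y hy using chartInvariantField_eq v hy
  · filter_upwards [hnhds] with y hy using chartInvariantField_eq w hy

end LieGroupCalculus

/-! ### The derivative of the adjoint representation is the bracket -/

section AdjointDerivative

variable {E : Type*} [NormedAddCommGroup E] [NormedSpace ℝ E]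
  {G : Type*} [TopologicalSpace G] [Group G] [ChartedSpace E G] [LieGroup 𝓘(ℝ, E) ∞ G]

lemma contDiffAt_chartMul_left {y : E} (hy : y ∈ (oneChart E G).target) :
    ContDiffAt ℝ ∞ (chartMul E G) (oneChart E G 1, y) :=
  contDiffAt_chartMul (mem_extChartAt_target 1) hy (by
    rw [oneChart_symm_one, one_mul]
    exact (oneChart E G).map_target hy)

lemma contDiffAt_chartMul_right {y : E} (hy : y ∈ (oneChart E G).target) :
    ContDiffAt ℝ ∞ (chartMul E G) (y, oneChart E G 1) :=
  contDiffAt_chartMul hy (mem_extChartAt_target 1) (by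
    rw [oneChart_symm_one, mul_one]
    exact (oneChart E G).map_target hy)

lemma contDiffAt_chartConj_right {y : E} (hy : y ∈ (oneChart E G).target) :
    ContDiffAt ℝ ∞ (chartConj E G) (y, oneChart E G 1) :=
  contDiffAt_chartConj hy (mem_extChartAt_target 1) (by
    rw [oneChart_symm_one, mul_one, mul_inv_cancel]
    exact mem_extChartAt_source 1)

lemma fderiv_chartMul_one_left (v : E) :
    fderiv ℝ (chartMul E G) (oneChart E G 1, oneChart E G 1) (v, 0) = v := by
  have hd := (contDiffAt_chartMul_left (mem_extChartAt_target (I := 𝓘(ℝ, E)) (1 : G))).differentiableAt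
    (by simp)
  have h1 := hd.hasFDerivAt.comp (oneChart E G 1) (f := fun z => (z, oneChart E G 1))
    (hasFDerivAt_prodMk_left (𝕜 := ℝ) (oneChart E G 1) (oneChart E G 1))
  have h2 : HasFDerivAt (chartMul E G ∘ fun z => (z, oneChart E G 1))
      (ContinuousLinearMap.id ℝ E) (oneChart E G 1) := by
    refine (hasFDerivAt_id _).congr_of_eventuallyEq ?_
    filter_upwards [extChartAt_target_mem_nhds (I := 𝓘(ℝ, E)) (1 : G)] with z hz
    simp only [Function.comp_apply, chartMul, oneChart_symm_one, mul_one]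
    exact (oneChart E G).right_inv hz
  simpa using congrArg (fun L => L v) (h1.unique h2)

lemma fderiv_chartMul_one_right (v : E) :
    fderiv ℝ (chartMul E G) (oneChart E G 1, oneChart E G 1) (0, v) = v := by
  have hd := (contDiffAt_chartMul_left (mem_extChartAt_target (I := 𝓘(ℝ, E)) (1 : G))).differentiableAt
    (by simp)
  have h1 := hd.hasFDerivAt.comp (oneChart E G 1) (f := fun z => (oneChart E G 1, z))
    (hasFDerivAt_prodMk_right (𝕜 := ℝ) (oneChart E G 1) (oneChart E G 1))
  have h2 : HasFDerivAt (chartMul E G ∘ fun z => (oneChart E G 1, z))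
      (ContinuousLinearMap.id ℝ E) (oneChart E G 1) := by
    refine (hasFDerivAt_id _).congr_of_eventuallyEq ?_
    filter_upwards [extChartAt_target_mem_nhds (I := 𝓘(ℝ, E)) (1 : G)] with z hz
    simp only [Function.comp_apply, chartMul, oneChart_symm_one, one_mul]
    exact (oneChart E G).right_inv hz
  simpa using congrArg (fun L => L v) (h1.unique h2)

omit [LieGroup 𝓘(ℝ, E) ∞ G] in
lemma chartConj_one (y : E) : chartConj E G (y, oneChart E G 1) = oneChart E G 1 := by
  simp [chartConj]

/-- The derivative of `c(y, z) y = y z` in `z`, at `z = e`. -/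
lemma fderiv_chartMul_chartConj {y : E} (hy : y ∈ (oneChart E G).target) (w : E) :
    fderiv ℝ (chartMul E G) (oneChart E G 1, y)
        (fderiv ℝ (chartConj E G) (y, oneChart E G 1) (0, w), 0) =
      fderiv ℝ (chartMul E G) (y, oneChart E G 1) (0, w) := by
  have hr := hasFDerivAt_prodMk_right (𝕜 := ℝ) y (oneChart E G 1)
  have hC := ((contDiffAt_chartConj_right hy).differentiableAt (by simp)).hasFDerivAt.comp
    (oneChart E G 1) hr
  have hm := ((contDiffAt_chartMul_right hy).differentiableAt (by simp)).hasFDerivAt.comp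
    (oneChart E G 1) hr
  have hl := ((contDiffAt_chartMul_left hy).differentiableAt (by simp)).hasFDerivAt
  -- The base point must have the form (c(y, e), y) for the chain rule along z ↦ (c(y, z), y).
  rw [← chartConj_one (G := G) y] at hl
  have h1 := hl.comp (oneChart E G 1)
    (f := fun z => (chartConj E G (y, z), y)) (hC.prodMk (hasFDerivAt_const y _))
  -- The identity (y z y⁻¹) y = y z survives in the chart only while y z y⁻¹ stays in its source. By
  -- continuity this holds for z near e.
  have hev : (fun z => chartMul E G (chartConj E G (y, z), y)) =ᶠ[𝓝 (oneChart E G 1)]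
      (fun z => chartMul E G (y, z)) := by
    have hc : ContinuousAt (fun z : E => (oneChart E G).symm y * (oneChart E G).symm z *
        ((oneChart E G).symm y)⁻¹) (oneChart E G 1) := by
      have := ((contMDiffAt_const (I := 𝓘(ℝ, E)) (n := ∞) (c := (oneChart E G).symm y)).mul
        (contMDiffAt_extChartAt_symm_comp (F := E) (n := ∞) (p := (1 : G)) (a := id)
          (x := oneChart E G 1) contDiffAt_id (mem_extChartAt_target 1))).mul
        (contMDiffAt_const (I' := 𝓘(ℝ, E)) (c := ((oneChart E G).symm y)⁻¹))
      exact this.continuousAt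
    have hs : (oneChart E G).source ∈ 𝓝 ((oneChart E G).symm y *
        (oneChart E G).symm (oneChart E G 1) * ((oneChart E G).symm y)⁻¹) := by
      rw [oneChart_symm_one, mul_one, mul_inv_cancel]
      exact extChartAt_source_mem_nhds 1
    filter_upwards [hc hs] with z hz
    have : (oneChart E G).symm (chartConj E G (y, z)) = _ := (oneChart E G).left_inv hz
    simp only [chartMul, this]
    simp
  have h2 := (h1.congr_of_eventuallyEq hev.symm).unique hm
  have h3 := congrArg (fun L => L w) h2
  rw [chartConj_one] at h3
  simpa using h3

/-- The derivative of `y ↦ Ad_y w` at the neutral element is the bracket. -/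
lemma hasFDerivAt_chartConj (v w : E) : ∃ L : E →L[ℝ] E,
    HasFDerivAt (fun y => fderiv ℝ (chartConj E G) (y, oneChart E G 1) (0, w)) L (oneChart E G 1) ∧
      L v = modelBracket G v w := by
  set z₀ := oneChart E G 1 with hz₀
  have hz : z₀ ∈ (oneChart E G).target := mem_extChartAt_target 1
  have hm := contDiffAt_chartMul_left hz
  rw [← hz₀] at hm
  have hm' : HasFDerivAt (fderiv ℝ (chartMul E G)) (fderiv ℝ (fderiv ℝ (chartMul E G)) (z₀, z₀))
      (z₀, z₀) :=
    ((hm.fderiv_right (m := 1) (by norm_cast)).differentiableAt (by simp)).hasFDerivAt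
  have hsymm : IsSymmSndFDerivAt ℝ (chartMul E G) (z₀, z₀) :=
    hm.isSymmSndFDerivAt (by
      rw [minSmoothness_of_isRCLikeNormedField]
      exact ENat.LEInfty.out)
  set m₂ := fderiv ℝ (fderiv ℝ (chartMul E G)) (z₀, z₀)
  -- The derivative at e of the invariant field of u is v ↦ m₂(v, 0)(0, u).
  have hV : ∀ u : E, HasFDerivAt (fun y => fderiv ℝ (chartMul E G) (y, z₀) (0, u))
      ((ContinuousLinearMap.apply ℝ E ((0, u) : E × E)).comp
        (m₂.comp (ContinuousLinearMap.inl ℝ E E))) z₀ := fun u =>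
    (ContinuousLinearMap.apply ℝ E ((0, u) : E × E)).hasFDerivAt.comp z₀
      (HasFDerivAt.comp (g := fderiv ℝ (chartMul E G)) (f := fun y => (y, z₀)) z₀ hm'
        (hasFDerivAt_prodMk_left (𝕜 := ℝ) z₀ z₀))
  have hA : DifferentiableAt ℝ (fun y => fderiv ℝ (chartConj E G) (y, z₀) (0, w)) z₀ := by
    have h1 := ((contDiffAt_chartConj_right hz).fderiv_right (m := 1)
      (by norm_cast)).differentiableAt (by simp)
    have h2 : DifferentiableAt ℝ (fun y => fderiv ℝ (chartConj E G) (y, z₀)) z₀ :=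
      DifferentiableAt.comp (g := fderiv ℝ (chartConj E G)) (f := fun y : E => (y, z₀)) z₀ h1
        (hasFDerivAt_prodMk_left (𝕜 := ℝ) z₀ z₀).differentiableAt
    exact h2.clm_apply (differentiableAt_const _)
  refine ⟨_, hA.hasFDerivAt, ?_⟩
  set A' := fderiv ℝ (fun y => fderiv ℝ (chartConj E G) (y, z₀) (0, w)) z₀
  -- Ad_e w = w, obtained by putting y = e in `fderiv_chartMul_chartConj`.
  have hA0 : fderiv ℝ (chartConj E G) (z₀, z₀) (0, w) = w := by
    have := fderiv_chartMul_chartConj (G := G) hz w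
    rwa [← hz₀, hz₀, fderiv_chartMul_one_left, fderiv_chartMul_one_right] at this
  have hleft : HasFDerivAt (fun y => fderiv ℝ (chartMul E G) (z₀, y))
      (m₂.comp (ContinuousLinearMap.inr ℝ E E)) z₀ :=
    HasFDerivAt.comp (g := fderiv ℝ (chartMul E G)) (f := fun y => (z₀, y)) z₀ hm'
      (hasFDerivAt_prodMk_right (𝕜 := ℝ) z₀ z₀)
  -- Both sides of `fderiv_chartMul_chartConj` are differentiated at y = e in the direction v. The
  -- outcome is m₂(0, v)(w, 0) + A' v = m₂(v, 0)(0, w).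
  have h1 := hleft.clm_apply (hA.hasFDerivAt.prodMk (hasFDerivAt_const (0 : E) z₀))
  have h2 := (hV w).congr_of_eventuallyEq (f₁ := fun y => fderiv ℝ (chartMul E G) (z₀, y)
      (fderiv ℝ (chartConj E G) (y, z₀) (0, w), 0)) (by
    filter_upwards [extChartAt_target_mem_nhds (I := 𝓘(ℝ, E)) (1 : G)] with y hy
    exact fderiv_chartMul_chartConj hy w)
  have h3 := congrArg (fun L => L v) (h1.unique h2)
  simp only [hA0, add_apply, ContinuousLinearMap.comp_apply,
    ContinuousLinearMap.prod_apply, zero_apply, ContinuousLinearMap.inr_apply,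
    ContinuousLinearMap.inl_apply, ContinuousLinearMap.flip_apply,
    ContinuousLinearMap.apply_apply] at h3
  rw [hz₀, fderiv_chartMul_one_left] at h3
  -- The bracket is m₂(v, 0)(0, w) - m₂(w, 0)(0, v). By symmetry of m₂ this is A' v.
  rw [modelBracket_eq_lieBracket_chart, VectorField.lieBracket_eq]
  simp only [← hz₀, (hV _).fderiv]
  simp only [hz₀, fderiv_chartMul_one_right, ContinuousLinearMap.comp_apply,
    ContinuousLinearMap.inl_apply, ContinuousLinearMap.apply_apply]
  rw [← h3, hsymm.eq (w, 0) (0, v)]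
  abel

variable (G) in
/-- The curve `p` in `G` passes through `e` at time `t`, with velocity `v`. -/
structure HasVelocityAtOne (p : ℝ → G) (t : ℝ) (v : E) : Prop where
  eq_one : p t = 1
  mdifferentiableAt : MDifferentiableAt 𝓘(ℝ, ℝ) 𝓘(ℝ, E) p t
  tderiv_eq : tderiv ℝ E p t 1 = v

lemma HasVelocityAtOne.hasDerivAt {p : ℝ → G} {t : ℝ} {v : E} (h : HasVelocityAtOne G p t v) :
    HasDerivAt (fun r => oneChart E G (p r)) v t := by
  have h1 := mdifferentiableAt_oneChart (E := E) (G := G) (mem_extChartAt_source 1)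
  have h2 : MDifferentiableAt 𝓘(ℝ, ℝ) 𝓘(ℝ, E) (oneChart E G ∘ p) t := by
    refine MDifferentiableAt.comp t ?_ h.mdifferentiableAt
    rwa [h.eq_one]
  have h3 := tderiv_comp_apply h.eq_one h1 h.mdifferentiableAt (1 : ℝ)
  rw [tderiv_extChartAt, h.tderiv_eq, tderiv_eq_fderiv] at h3
  have h4 := h2.differentiableAt.hasFDerivAt.hasDerivAt
  rwa [h3] at h4

/-- The derivative of `Ad` along a curve through `e` is the bracket with the velocity. -/
theorem HasVelocityAtOne.hasDerivAt_conj {p : ℝ → G} {t : ℝ} {v : E}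
    (h : HasVelocityAtOne G p t v) (w : E) :
    HasDerivAt (fun r => tderiv E E (fun x : G => p r * x * (p r)⁻¹) 1 w)
      (modelBracket G v w) t := by
  obtain ⟨L, hL, hLv⟩ := hasFDerivAt_chartConj (G := G) v w
  have h1 : HasFDerivAt (fun y => fderiv ℝ (chartConj E G) (y, oneChart E G 1) (0, w)) L
      (oneChart E G (p t)) := by rwa [h.eq_one]
  rw [← hLv]
  refine (h1.comp_hasDerivAt t h.hasDerivAt).congr_of_eventuallyEq ?_
  have hs : (oneChart E G).source ∈ 𝓝 (p t) := by
    rw [h.eq_one]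
    exact extChartAt_source_mem_nhds 1
  filter_upwards [h.mdifferentiableAt.continuousAt hs] with r hr
  have := fderiv_chartConj_snd (G := G) ((oneChart E G).map_source hr) w
  rw [(oneChart E G).left_inv hr] at this
  exact this.symm

end AdjointDerivative

/-! ### Homomorphisms, left translation and logarithmic derivatives -/

section LeftTranslation

variable {E : Type*} [NormedAddCommGroup E] [NormedSpace ℝ E]
  {G : Type*} [TopologicalSpace G] [Group G] [ChartedSpace E G] [LieGroup 𝓘(ℝ, E) ∞ G]
  {E' : Type*} [NormedAddCommGroup E'] [NormedSpace ℝ E']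
  {H : Type*} [TopologicalSpace H] [Group H] [ChartedSpace E' H] [LieGroup 𝓘(ℝ, E') ∞ H]

omit [LieGroup 𝓘(ℝ, E) ∞ G] [LieGroup 𝓘(ℝ, E') ∞ H] in
lemma HasVelocityAtOne.map {p : ℝ → G} {t : ℝ} {v : E} (h : HasVelocityAtOne G p t v) {f : G → H}
    (hf : MDifferentiableAt 𝓘(ℝ, E) 𝓘(ℝ, E') f 1) (hf1 : f 1 = 1) :
    HasVelocityAtOne H (f ∘ p) t (tderiv E E' f 1 v) where
  eq_one := by simp [h.eq_one, hf1]
  mdifferentiableAt := by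
    refine MDifferentiableAt.comp t ?_ h.mdifferentiableAt
    rwa [h.eq_one]
  tderiv_eq := by rw [tderiv_comp_apply h.eq_one hf h.mdifferentiableAt, h.tderiv_eq]

/-- A straight line in the chart, used to test identities between derivatives at e. -/
lemma exists_hasVelocityAtOne (v : E) : ∃ p : ℝ → G, HasVelocityAtOne G p 0 v := by
  have hc : HasDerivAt (fun r : ℝ => oneChart E G 1 + r • v) v 0 := by
    simpa using ((hasDerivAt_id (0 : ℝ)).smul_const v).const_add (oneChart E G 1)
  have h0 : oneChart E G 1 + (0 : ℝ) • v = oneChart E G 1 := by simp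
  have hs := mdifferentiableAt_extChartAt_symm (F := E) (x := (1 : G)) (mem_extChartAt_target 1)
  refine ⟨(oneChart E G).symm ∘ fun r : ℝ => oneChart E G 1 + r • v, ?_, ?_, ?_⟩
  · simp only [Function.comp_apply, h0, oneChart_symm_one]
  · refine MDifferentiableAt.comp 0 ?_ hc.differentiableAt.mdifferentiableAt
    rwa [h0]
  · rw [tderiv_comp_apply (f := fun r : ℝ => oneChart E G 1 + r • v) h0 hs
      hc.differentiableAt.mdifferentiableAt, tderiv_extChartAt_symm,
      tderiv_eq_fderiv, hc.hasFDerivAt.fderiv]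
    simp

/-- The derivative of a homomorphism of Lie groups is a homomorphism of Lie algebras. -/
theorem tderiv_modelBracket (f : G →* H) (hf : MDifferentiableAt 𝓘(ℝ, E) 𝓘(ℝ, E') f 1) (v w : E) :
    tderiv E E' f 1 (modelBracket G v w) =
      modelBracket H (tderiv E E' f 1 v) (tderiv E E' f 1 w) := by
  obtain ⟨p, hp⟩ := exists_hasVelocityAtOne (G := G) v
  -- Both sides are derivatives at 0 of one curve, since Df (Ad_{p(r)} w) = Ad_{f(p(r))} (Df w).
  have h1 := (tderiv E E' f 1).hasFDerivAt.comp_hasDerivAt 0 (hp.hasDerivAt_conj w)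
  have h2 := (hp.map hf (map_one f)).hasDerivAt_conj (tderiv E E' f 1 w)
  refine h1.unique (h2.congr_of_eventuallyEq (Eventually.of_forall fun r => ?_))
  have e : f ∘ (fun x : G => p r * x * (p r)⁻¹) =
      (fun y : H => f (p r) * y * (f (p r))⁻¹) ∘ f := by
    ext x
    simp
  have e1 := tderiv_comp_apply (F := E) (F' := E) (F'' := E') (f := fun x : G => p r * x * (p r)⁻¹)
    (g := f) (x := 1) (y := 1) (by simp) hf (mdifferentiable_conj _ _) w
  have e2 := tderiv_comp_apply (F := E) (F' := E') (F'' := E')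
    (g := fun y : H => f (p r) * y * (f (p r))⁻¹) (map_one f) (mdifferentiable_conj _ _) hf w
  exact e1.symm.trans ((congrArg (fun k => tderiv E E' k 1 w) e).trans e2)

/-- The left translation of `𝔤` to the tangent space at `g`. -/
def leftD (g : G) : E →L[ℝ] E := tderiv E E (fun x : G => g * x) 1

lemma tderiv_mul_left_comp (g h : G) :
    (tderiv E E (fun x : G => g * x) h).comp (leftD h) = leftD (g * h) := by
  rw [leftD, leftD, ← tderiv_comp (mul_one h) (mdifferentiable_mul_left g h)
    (mdifferentiable_mul_left h 1)]
  congr 1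
  ext x
  simp [mul_assoc]

omit [LieGroup 𝓘(ℝ, E) ∞ G] in
lemma leftD_one : leftD (1 : G) = ContinuousLinearMap.id ℝ E := by
  rw [leftD, ← tderiv_id (F := E) (1 : G)]
  congr 1
  ext x
  simp

lemma tderiv_inv_mul_leftD (g : G) (v : E) :
    tderiv E E (fun x : G => g⁻¹ * x) g (leftD g v) = v := by
  have := congrArg (fun L => L v) (tderiv_mul_left_comp (E := E) g⁻¹ g)
  rw [inv_mul_cancel, leftD_one] at this
  exact this

lemma leftD_tderiv_inv_mul (g : G) (v : E) :
    leftD g (tderiv E E (fun x : G => g⁻¹ * x) g v) = v := by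
  rw [leftD, ← tderiv_comp_apply (inv_mul_cancel g) (mdifferentiable_mul_left g 1)
    (mdifferentiable_mul_left g⁻¹ g)]
  have : (fun x : G => g * x) ∘ (fun x : G => g⁻¹ * x) = id := by
    ext x
    simp
  rw [this, tderiv_id]
  rfl

lemma leftD_injective (g : G) : Function.Injective (leftD (E := E) g) :=
  Function.LeftInverse.injective (tderiv_inv_mul_leftD g)

lemma leftD_surjective (g : G) : Function.Surjective (leftD (E := E) g) :=
  Function.RightInverse.surjective (leftD_tderiv_inv_mul g)

/-- The derivative of f(g x) = f(g) f(x) at x = e. -/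
lemma tderiv_leftD (f : G →* H) (hf : MDifferentiable 𝓘(ℝ, E) 𝓘(ℝ, E') f) (g : G) (v : E) :
    tderiv E E' f g (leftD g v) = leftD (f g) (tderiv E E' f 1 v) := by
  rw [leftD, leftD, ← tderiv_comp_apply (mul_one g) (hf g) (mdifferentiable_mul_left g 1),
    ← tderiv_comp_apply (map_one f) (mdifferentiable_mul_left _ _) (hf 1)]
  congr 2
  ext x
  simp

/-- The curve `q` in `G` has at time `t` the velocity `q(t) ξ`. -/
structure HasLogDerivAt (q : ℝ → G) (ξ : E) (t : ℝ) : Prop where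
  mdifferentiableAt : MDifferentiableAt 𝓘(ℝ, ℝ) 𝓘(ℝ, E) q t
  tderiv_eq : tderiv ℝ E q t 1 = leftD (q t) ξ

lemma exists_hasLogDerivAt {q : ℝ → G} {t : ℝ} (hq : MDifferentiableAt 𝓘(ℝ, ℝ) 𝓘(ℝ, E) q t) :
    ∃ ξ : E, HasLogDerivAt q ξ t := by
  obtain ⟨ξ, hξ⟩ := leftD_surjective (q t) (tderiv ℝ E q t 1)
  exact ⟨ξ, hq, hξ.symm⟩

lemma HasLogDerivAt.unique {q : ℝ → G} {t : ℝ} {ξ η : E} (h : HasLogDerivAt q ξ t)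
    (h' : HasLogDerivAt q η t) : ξ = η :=
  leftD_injective (q t) (h.tderiv_eq.symm.trans h'.tderiv_eq)

lemma HasLogDerivAt.mul_left {q : ℝ → G} {t : ℝ} {ξ : E} (h : HasLogDerivAt q ξ t) (g : G) :
    HasLogDerivAt (fun r => g * q r) ξ t where
  mdifferentiableAt := (mdifferentiable_mul_left g (q t)).comp t h.mdifferentiableAt
  tderiv_eq := by
    have := tderiv_comp_apply (F'' := E) rfl (mdifferentiable_mul_left g (q t)) h.mdifferentiableAt
      (1 : ℝ)
    rw [← tderiv_mul_left_comp, ContinuousLinearMap.comp_apply, ← h.tderiv_eq, ← this]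
    rfl

/-- Translation by q(t)⁻¹ moves the curve to e, where the calculus of `Ad` applies. -/
lemma HasLogDerivAt.hasVelocityAtOne {q : ℝ → G} {t : ℝ} {ξ : E} (h : HasLogDerivAt q ξ t) :
    HasVelocityAtOne G (fun r => (q t)⁻¹ * q r) t ξ := by
  have h1 := h.mul_left (q t)⁻¹
  refine ⟨inv_mul_cancel _, h1.mdifferentiableAt, ?_⟩
  rw [h1.tderiv_eq, inv_mul_cancel, leftD_one]
  rfl

lemma HasLogDerivAt.map {q : ℝ → G} {t : ℝ} {ξ : E} (h : HasLogDerivAt q ξ t) (f : G →* H)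
    (hf : MDifferentiable 𝓘(ℝ, E) 𝓘(ℝ, E') f) :
    HasLogDerivAt (fun r => f (q r)) (tderiv E E' f 1 ξ) t where
  mdifferentiableAt := (hf _).comp t h.mdifferentiableAt
  tderiv_eq := by
    rw [← tderiv_leftD f hf, ← h.tderiv_eq]
    exact tderiv_comp_apply rfl (hf _) h.mdifferentiableAt 1

/-- Two curves with the same logarithmic derivative differ by a left translation to first order. -/
lemma HasLogDerivAt.tderiv_mul_inv {q p : ℝ → G} {t : ℝ} {ξ : E} (hq : HasLogDerivAt q ξ t)
    (hp : HasLogDerivAt p ξ t) :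
    MDifferentiableAt 𝓘(ℝ, ℝ) 𝓘(ℝ, E) (fun r => p r * (q r)⁻¹) t ∧
      tderiv ℝ E (fun r => p r * (q r)⁻¹) t = 0 := by
  set z₀ := oneChart E G 1
  have hz : z₀ ∈ (oneChart E G).target := mem_extChartAt_target 1
  -- p(r) q(r)⁻¹ = p(t) · (p(t)⁻¹ p(r)) · (q(t)⁻¹ q(r))⁻¹ · q(t)⁻¹, with the two curves through e
  -- replaced by chart variables.
  let W : E × E → G := fun y => p t * (oneChart E G).symm y.1 * ((oneChart E G).symm y.2)⁻¹ * (q t)⁻¹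
  have hW : MDifferentiableAt 𝓘(ℝ, E × E) 𝓘(ℝ, E) W (z₀, z₀) :=
    (((contMDiffAt_const.mul (contMDiffAt_symm_fst (y := (z₀, z₀)) hz)).mul
      (contMDiffAt_symm_snd (y := (z₀, z₀)) hz).inv).mul contMDiffAt_const).mdifferentiableAt
      (by simp)
  have hc := hp.hasVelocityAtOne.hasDerivAt.prodMk hq.hasVelocityAtOne.hasDerivAt
  set c : ℝ → E × E := fun r => (oneChart E G ((p t)⁻¹ * p r), oneChart E G ((q t)⁻¹ * q r))
  have hct : c t = (z₀, z₀) := by simp [c, z₀]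
  have hev : (fun r => p r * (q r)⁻¹) =ᶠ[𝓝 t] W ∘ c := by
    have hs : ∀ {k : ℝ → G}, HasLogDerivAt k ξ t →
        ∀ᶠ r in 𝓝 t, (k t)⁻¹ * k r ∈ (oneChart E G).source := fun {k} hk => by
      have h1 := hk.hasVelocityAtOne.mdifferentiableAt.continuousAt
      refine h1 ?_
      beta_reduce
      rw [inv_mul_cancel]
      exact extChartAt_source_mem_nhds 1
    filter_upwards [hs hp, hs hq] with r h1 h2
    simp only [W, c, Function.comp_apply, (oneChart E G).left_inv h1, (oneChart E G).left_inv h2]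
    group
  have hcm : MDifferentiableAt 𝓘(ℝ, ℝ) 𝓘(ℝ, E × E) c t := hc.differentiableAt.mdifferentiableAt
  refine ⟨MDifferentiableAt.congr_of_eventuallyEq
    (MDifferentiableAt.comp t (by rwa [hct]) hcm) hev, ?_⟩
  -- W is constant on the diagonal, and (ξ, ξ) is the velocity of c because the logarithmic
  -- derivatives agree.
  have hdiag : tderiv (E × E) E W (z₀, z₀) (ξ, ξ) = 0 := by
    have hd : HasFDerivAt (fun y : E => (y, y))
      ((ContinuousLinearMap.id ℝ E).prod (ContinuousLinearMap.id ℝ E)) z₀ :=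
      (hasFDerivAt_id z₀).prodMk (hasFDerivAt_id z₀)
    have h1 := tderiv_comp_apply (F := E) (f := fun y : E => (y, y)) rfl hW
      hd.differentiableAt.mdifferentiableAt ξ
    rw [tderiv_eq_fderiv, hd.fderiv] at h1
    have h2 : W ∘ (fun y : E => (y, y)) = fun _ => p t * (q t)⁻¹ := by
      ext y
      simp [W]
    rw [h2, tderiv_const] at h1
    exact h1.symm
  rw [tderiv_congr hev]
  ext
  rw [tderiv_comp_apply hct hW hcm, tderiv_eq_fderiv, hc.hasFDerivAt.fderiv]
  simpa using hdiag

end LeftTranslation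

/-! ### Curves with zero derivative -/

section Constant

variable {F : Type*} [NormedAddCommGroup F] [NormedSpace ℝ F] {M : Type*} [TopologicalSpace M]
  [ChartedSpace F M] [IsManifold 𝓘(ℝ, F) 1 M]

/-- A curve with zero velocity is constant. -/
lemma eq_of_tderiv_eq_zero {n : ℝ → M} {s : Set ℝ} (hs : Convex ℝ s)
    (hn : ∀ t ∈ s, MDifferentiableAt 𝓘(ℝ, ℝ) 𝓘(ℝ, F) n t)
    (h0 : ∀ t ∈ s, tderiv ℝ F n t = 0) {a b : ℝ} (ha : a ∈ s) (hb : b ∈ s) : n a = n b := by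
  have : PreconnectedSpace s := Subtype.preconnectedSpace hs.isPreconnected
  -- Local constancy comes from the mean value inequality in a chart, with bound 0 on the convex set
  -- s ∩ ball; connectedness of s makes it global.
  have hloc : IsLocallyConstant (fun t : s => n t) := by
    rw [IsLocallyConstant.iff_eventually_eq]
    rintro ⟨t, ht⟩
    have hsrc : n ⁻¹' (extChartAt 𝓘(ℝ, F) (n t)).source ∈ 𝓝 t :=
      (hn t ht).continuousAt (extChartAt_source_mem_nhds (n t))
    obtain ⟨ε, hε, hball⟩ := Metric.mem_nhds_iff.1 hsrc
    have hd : ∀ r ∈ s ∩ Metric.ball t ε,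
        HasFDerivAt (extChartAt 𝓘(ℝ, F) (n t) ∘ n : ℝ → F) (0 : ℝ →L[ℝ] F) r := by
      rintro r ⟨hr, hrb⟩
      have h1 : n r ∈ (extChartAt 𝓘(ℝ, F) (n t)).source := hball hrb
      have h2 : MDifferentiableAt 𝓘(ℝ, F) 𝓘(ℝ, F) (extChartAt 𝓘(ℝ, F) (n t)) (n r) :=
        mdifferentiableAt_extChartAt (by rwa [extChartAt_source] at h1)
      have h3 := (h2.comp r (hn r hr)).differentiableAt.hasFDerivAt
      rwa [← tderiv_eq_fderiv, tderiv_comp rfl h2 (hn r hr), h0 r hr,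
        ContinuousLinearMap.comp_zero] at h3
    have hev : ∀ᶠ r : s in 𝓝 ⟨t, ht⟩, (r : ℝ) ∈ Metric.ball t ε :=
      continuous_subtype_val.continuousAt (Metric.ball_mem_nhds t hε)
    filter_upwards [hev] with r hr
    have hconv : Convex ℝ (s ∩ Metric.ball t ε) := hs.inter (convex_ball t ε)
    have h1 : extChartAt 𝓘(ℝ, F) (n t) (n r) = extChartAt 𝓘(ℝ, F) (n t) (n t) := by
      have := hconv.norm_image_sub_le_of_norm_hasFDerivWithin_le (C := 0)
        (f := extChartAt 𝓘(ℝ, F) (n t) ∘ n) (f' := fun _ => (0 : ℝ →L[ℝ] F))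
        (fun x hx => (hd x hx).hasFDerivWithinAt) (fun x _ => by simp)
        ⟨ht, Metric.mem_ball_self hε⟩ ⟨r.2, hr⟩
      simpa [sub_eq_zero] using this
    exact (extChartAt 𝓘(ℝ, F) (n t)).injOn (hball hr) (mem_extChartAt_source _) h1
  exact hloc.apply_eq_of_preconnectedSpace ⟨a, ha⟩ ⟨b, hb⟩

end Constant

/-! ### Curves with prescribed logarithmic derivative -/

section Integration

variable {E : Type*} [NormedAddCommGroup E] [NormedSpace ℝ E]
  {G : Type*} [TopologicalSpace G] [Group G] [ChartedSpace E G] [LieGroup 𝓘(ℝ, E) ∞ G]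

lemma tderiv_oneChart_symm_tderiv {y : E} (hy : y ∈ (oneChart E G).target) (v : E) :
    tderiv E E (oneChart E G).symm y (tderiv E E (oneChart E G) ((oneChart E G).symm y) v) = v := by
  have hg := (oneChart E G).map_target hy
  have hyg := (oneChart E G).right_inv hy
  rw [← tderiv_comp_apply hyg (mdifferentiableAt_extChartAt_symm hy)
    (mdifferentiableAt_oneChart hg)]
  have : (oneChart E G).symm ∘ oneChart E G =ᶠ[𝓝 ((oneChart E G).symm y)] id := by
    filter_upwards [(isOpen_extChartAt_source (1 : G)).mem_nhds hg] with x hx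
    exact (oneChart E G).left_inv hx
  rw [tderiv_congr this, tderiv_id]
  rfl

/-- Logarithmic derivatives of curves in the chart at the neutral element. -/
lemma hasLogDerivAt_of_chart {y : ℝ → E} {t : ℝ} {ξ : E} (hy : y t ∈ (oneChart E G).target)
    (h : HasDerivAt y (fderiv ℝ (chartMul E G) (y t, oneChart E G 1) (0, ξ)) t) :
    HasLogDerivAt (fun r => (oneChart E G).symm (y r)) ξ t where
  mdifferentiableAt := (mdifferentiableAt_extChartAt_symm hy).comp t
    h.differentiableAt.mdifferentiableAt
  tderiv_eq := by
    have h1 := tderiv_comp_apply (F'' := E) rfl (mdifferentiableAt_extChartAt_symm hy)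
      h.differentiableAt.mdifferentiableAt (1 : ℝ)
    rw [tderiv_eq_fderiv, h.hasFDerivAt.fderiv, ContinuousLinearMap.toSpanSingleton_apply, one_smul,
      fderiv_chartMul_snd hy, tderiv_oneChart_symm_tderiv hy] at h1
    exact h1

/-- A curve with prescribed logarithmic derivative and initial value exists locally. -/
theorem exists_hasLogDerivAt_eq [CompleteSpace E] {ξ : ℝ → E} {t₀ : ℝ} (hξ : ContDiffAt ℝ 1 ξ t₀)
    (g : G) : ∃ q : ℝ → G, q t₀ = g ∧
      ∀ᶠ t in 𝓝 t₀, ContMDiffAt 𝓘(ℝ, ℝ) 𝓘(ℝ, E) 1 q t ∧ HasLogDerivAt q (ξ t) t := by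
  set z₀ := oneChart E G 1 with hz₀
  have hz : z₀ ∈ (oneChart E G).target := mem_extChartAt_target 1
  -- Time is added as a coordinate, so that y' = y ξ(t) becomes autonomous.
  let f : ℝ × E → ℝ × E := fun p => (1, fderiv ℝ (chartMul E G) (p.2, z₀) (0, ξ p.1))
  have hf : ContDiffAt ℝ 1 f (t₀, z₀) := by
    have h1 : ContDiffAt ℝ 1 (fderiv ℝ (chartMul E G)) (z₀, z₀) :=
      (contDiffAt_chartMul_left hz).fderiv_right (m := 1) (by norm_cast)
    have h2 : ContDiffAt ℝ 1 (fun p : ℝ × E => fderiv ℝ (chartMul E G) (p.2, z₀)) (t₀, z₀) :=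
      ContDiffAt.comp (g := fderiv ℝ (chartMul E G)) (f := fun p : ℝ × E => (p.2, z₀)) (t₀, z₀) h1
        (by fun_prop)
    have h3 : ContDiffAt ℝ 1 (fun p : ℝ × E => ((0 : E), ξ p.1)) (t₀, z₀) :=
      contDiffAt_const.prodMk (ContDiffAt.comp (g := ξ) (f := Prod.fst) (t₀, z₀) hξ contDiffAt_fst)
    exact contDiffAt_const.prodMk (h2.clm_apply h3)
  obtain ⟨α, hα0, ε, hε, hα⟩ :=
    hf.exists_forall_mem_closedBall_exists_eq_forall_mem_Ioo_hasDerivAt₀ t₀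
  have hI : Set.Ioo (t₀ - ε) (t₀ + ε) ∈ 𝓝 t₀ := Ioo_mem_nhds (by linarith) (by linarith)
  have ht₀ : t₀ ∈ Set.Ioo (t₀ - ε) (t₀ + ε) := ⟨by linarith, by linarith⟩
  -- The first component of the solution is time itself: its derivative is 1 and its value at t₀ is
  -- t₀.
  have hα1 : ∀ t ∈ Set.Ioo (t₀ - ε) (t₀ + ε), (α t).1 = t := by
    have h1 : ∀ t ∈ Set.Ioo (t₀ - ε) (t₀ + ε), HasDerivAt (fun s => (α s).1 - s) 0 t := by
      intro t ht
      have := ((hasFDerivAt_fst (𝕜 := ℝ) (p := α t)).comp_hasDerivAt t (hα t ht)).sub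
        (hasDerivAt_id t)
      simp only [f, ContinuousLinearMap.coe_fst', sub_self] at this
      exact this
    intro t ht
    have := isOpen_Ioo.is_const_of_deriv_eq_zero isPreconnected_Ioo
      (fun s hs => (h1 s hs).differentiableAt.differentiableWithinAt)
      (fun s hs => (h1 s hs).deriv) ht ht₀
    simpa [hα0, sub_eq_zero] using this
  have hαc : ContinuousAt α t₀ := (hα t₀ ht₀).continuousAt
  -- The derivative of α is f ∘ α, which is continuous near t₀.
  have hαd : ContDiffAt ℝ 1 α t₀ := by
    rw [contDiffAt_one_iff]
    have h1 : ∀ᶠ t in 𝓝 t₀, ContDiffAt ℝ 1 f (α t) := by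
      have := hf.eventually (by simp)
      rw [← hα0] at this
      exact hαc.eventually this
    refine ⟨fun t => ContinuousLinearMap.toSpanSingleton ℝ (f (α t)), _, inter_mem hI h1,
      fun t ht => ?_, fun t ht => (hα t ht.1).hasFDerivAt⟩
    have h2 : ContinuousAt (fun s => f (α s)) t :=
      ContinuousAt.comp (g := f) (f := α) (ContDiffAt.continuousAt (n := 1) (𝕜 := ℝ) ht.2) (hα t ht.1).continuousAt
    exact ((ContinuousLinearMap.toSpanSingletonCLE (𝕜 := ℝ) (E := ℝ × E)).continuous.continuousAt.comp
      h2).continuousWithinAt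
  -- The solution starts at e; left translation by g moves its start without changing its
  -- logarithmic derivative.
  refine ⟨fun t => g * (oneChart E G).symm (α t).2, ?_, ?_⟩
  · simp only [hα0, hz₀, oneChart_symm_one, mul_one]
  · have htgt : ∀ᶠ t in 𝓝 t₀, (α t).2 ∈ (oneChart E G).target := by
      have : ContinuousAt (fun t => (α t).2) t₀ := hαc.snd
      refine this ?_
      beta_reduce
      rw [hα0]
      exact extChartAt_target_mem_nhds (I := 𝓘(ℝ, E)) (1 : G)
    filter_upwards [hI, htgt, hαd.eventually (by simp)] with t ht hty htd
    have hy : ContDiffAt ℝ 1 (fun s => (α s).2) t := contDiffAt_snd.comp t htd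
    refine ⟨contMDiffAt_const.mul (contMDiffAt_extChartAt_symm_comp hy hty), ?_⟩
    refine (hasLogDerivAt_of_chart hty ?_).mul_left g
    have := (hasFDerivAt_snd (𝕜 := ℝ) (p := α t)).comp_hasDerivAt t (hα t ht)
    simp only [f, ContinuousLinearMap.coe_snd', hα1 t ht] at this
    exact this

/-- The logarithmic derivative of a smooth curve is a smooth curve. -/
theorem exists_contDiff_hasLogDerivAt {x : ℝ → G} (hx : ContMDiff 𝓘(ℝ, ℝ) 𝓘(ℝ, E) ∞ x) :
    ∃ κ : ℝ → E, ContDiff ℝ 1 κ ∧ ∀ t, HasLogDerivAt x (κ t) t := by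
  -- For fixed t the curve s ↦ x(t)⁻¹ x(s) passes through e at s = t, so κ(t) is the derivative of f
  -- in its second variable on the diagonal.
  let f : ℝ × ℝ → E := fun p => oneChart E G ((x p.1)⁻¹ * x p.2)
  have hf : ∀ t, ContDiffAt ℝ ∞ f (t, t) := fun t => by
    refine contDiffAt_extChartAt_comp (n := ∞) (A := fun p : ℝ × ℝ => (x p.1)⁻¹ * x p.2) ?_ ?_
    · exact ((hx.contMDiffAt.comp (t, t) contDiffAt_fst.contMDiffAt).inv).mul
        (hx.contMDiffAt.comp (t, t) contDiffAt_snd.contMDiffAt)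
    · simp
  refine ⟨fun t => fderiv ℝ f (t, t) (0, 1), ?_, fun t => ?_⟩
  · rw [contDiff_iff_contDiffAt]
    intro t
    have h1 : ContDiffAt ℝ 1 (fderiv ℝ f) (t, t) := (hf t).fderiv_right (m := 1) (by norm_cast)
    have h2 : ContDiffAt ℝ 1 (fun s => fderiv ℝ f (s, s)) t :=
      ContDiffAt.comp (g := fderiv ℝ f) (f := fun s : ℝ => (s, s)) t h1 (by fun_prop)
    exact h2.clm_apply contDiffAt_const
  · obtain ⟨ξ, hξ⟩ := exists_hasLogDerivAt ((hx t).mdifferentiableAt (by simp))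
    have h1 := hξ.hasVelocityAtOne.hasDerivAt
    have h2 := (((hf t).differentiableAt (by simp)).hasFDerivAt.comp_hasDerivAt t
      (f := fun r : ℝ => (t, r)) ((hasDerivAt_const t t).prodMk (hasDerivAt_id t)))
    rwa [h1.unique h2] at hξ

/-- The curves through `g` whose velocity at time `0` is `g v`, defined and smooth on `ℝ`. -/
lemma exists_contMDiff_hasLogDerivAt (g : G) (v : E) : ∃ x : ℝ → G,
    ContMDiff 𝓘(ℝ, ℝ) 𝓘(ℝ, E) ∞ x ∧ x 0 = g ∧ HasLogDerivAt x v 0 := by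
  obtain ⟨ε, hε, hball⟩ := Metric.mem_nhds_iff.1 (extChartAt_target_mem_nhds (I := 𝓘(ℝ, E)) (1 : G))
  obtain ⟨δ, hδ, hδv⟩ : ∃ δ > 0, δ * ‖v‖ < ε :=
    ⟨ε / (‖v‖ + 1), by positivity, by
      rw [div_mul_eq_mul_div, div_lt_iff₀ (by positivity)]
      nlinarith [norm_nonneg v]⟩
  -- δ sin(t/δ) has derivative 1 at 0 and absolute value at most δ, so the curve has velocity v and
  -- never leaves the chart. Curves on all of ℝ are required because `IsNabla` tests only such
  -- curves.
  let y : ℝ → E := fun t => oneChart E G 1 + (δ * Real.sin (t / δ)) • v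
  have hyt : ∀ t, y t ∈ (oneChart E G).target := fun t => hball (by
    rw [Metric.mem_ball, dist_eq_norm, add_sub_cancel_left, norm_smul, Real.norm_eq_abs, abs_mul,
      abs_of_pos hδ]
    calc δ * |Real.sin (t / δ)| * ‖v‖ ≤ δ * 1 * ‖v‖ := by
          gcongr
          exact Real.abs_sin_le_one _
      _ < ε := by simpa using hδv)
  have hy : ContDiff ℝ ∞ y := by
    have : ContDiff ℝ ∞ fun t : ℝ => Real.sin (t / δ) := Real.contDiff_sin.comp (by fun_prop)
    exact contDiff_const.add ((contDiff_const.mul this).smul contDiff_const)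
  have hy0 : y 0 = oneChart E G 1 := by simp [y]
  have hyd : HasDerivAt y v 0 := by
    have h1 : HasDerivAt (fun t : ℝ => Real.sin (t / δ)) (1 / δ) 0 := by
      simpa using ((hasDerivAt_id (0 : ℝ)).div_const δ).sin
    have h2 := ((h1.const_mul δ).smul_const v).const_add (oneChart E G 1)
    rwa [mul_one_div_cancel hδ.ne', one_smul] at h2
  refine ⟨fun t => g * (oneChart E G).symm (y t), fun t => ?_, ?_, ?_⟩
  · exact contMDiffAt_const.mul (contMDiffAt_extChartAt_symm_comp hy.contDiffAt (hyt t))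
  · simp only [hy0, oneChart_symm_one, mul_one]
  · refine (hasLogDerivAt_of_chart (hyt 0) ?_).mul_left g
    rwa [hy0, fderiv_chartMul_one_right]

end Integration

/-! ### Derivatives of submersions and immersions -/

section Immersion

variable {F F' : Type*} [NormedAddCommGroup F] [NormedSpace ℝ F] [NormedAddCommGroup F']
  [NormedSpace ℝ F'] {M M' : Type*} [TopologicalSpace M] [ChartedSpace F M]
  [TopologicalSpace M'] [ChartedSpace F' M'] {x : M}

section

lemma openPartialHomeomorph_mdifferentiable {e : OpenPartialHomeomorph M F}
    (he : e ∈ IsManifold.maximalAtlas 𝓘(ℝ, F) ∞ M) : e.MDifferentiable 𝓘(ℝ, F) 𝓘(ℝ, F) :=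
  ⟨(contMDiffOn_of_mem_maximalAtlas he).mdifferentiableOn (by simp),
    (contMDiffOn_symm_of_mem_maximalAtlas he).mdifferentiableOn (by simp)⟩

lemma tderiv_symm_tderiv_chart {e : OpenPartialHomeomorph M F}
    (he : e ∈ IsManifold.maximalAtlas 𝓘(ℝ, F) ∞ M) (hx : x ∈ e.source) (v : F) :
    tderiv F F e.symm (e x) (tderiv F F e x v) = v := by
  exact congrArg (fun L : F →L[ℝ] F => L v)
    ((openPartialHomeomorph_mdifferentiable he).symm_comp_deriv hx)

end

variable {f : M → M'}

/-- The derivative of a submersion in the charts in which it is a projection. -/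
lemma tderiv_submersion (h : IsSubmersionAt 𝓘(ℝ, F) 𝓘(ℝ, F') ∞ f x) (u : F) :
    tderiv F' F' h.codChart (f x) (tderiv F F' f x (tderiv F F h.domChart.symm (h.domChart x) u)) =
      (h.equiv u).1 := by
  have hd := openPartialHomeomorph_mdifferentiable h.domChart_mem_maximalAtlas
  have hc := openPartialHomeomorph_mdifferentiable h.codChart_mem_maximalAtlas
  have hx := h.mem_domChart_source
  have hdx := hd.mdifferentiableAt_symm (h.domChart.map_source hx)
  have hf : MDifferentiableAt 𝓘(ℝ, F) 𝓘(ℝ, F') f x := h.contMDiffAt.mdifferentiableAt (by simp)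
  have hl := h.domChart.left_inv hx
  have hfd : MDifferentiableAt 𝓘(ℝ, F) 𝓘(ℝ, F') (f ∘ h.domChart.symm) (h.domChart x) :=
    MDifferentiableAt.comp _ (by rwa [hl]) hdx
  have hfl : (f ∘ h.domChart.symm) (h.domChart x) = f x := congrArg f hl
  rw [← tderiv_comp_apply hl hf hdx,
    ← tderiv_comp_apply hfl (hc.mdifferentiableAt h.mem_codChart_source) hfd]
  have hev : h.codChart ∘ f ∘ h.domChart.symm =ᶠ[𝓝 (h.domChart x)] fun u => (h.equiv u).1 := by
    filter_upwards [h.domChart.open_target.mem_nhds (h.domChart.map_source hx)] with z hz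
    have := h.writtenInCharts
        (show z ∈ (h.domChart.extend 𝓘(ℝ, F)).target by simpa using hz)
    simpa using this
  rw [tderiv_congr hev, tderiv_eq_fderiv]
  have : HasFDerivAt (fun u => (h.equiv u).1)
      ((ContinuousLinearMap.fst ℝ F' h.complement).comp (h.equiv : F →L[ℝ] F' × h.complement))
      (h.domChart x) :=
    ((ContinuousLinearMap.fst ℝ F' h.complement).comp
      (h.equiv : F →L[ℝ] F' × h.complement)).hasFDerivAt
  rw [this.fderiv]
  rfl

/-- In adapted charts the derivative is a linear projection, and the chart derivatives are
invertible. -/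
lemma tderiv_submersion_surjective (h : IsSubmersionAt 𝓘(ℝ, F) 𝓘(ℝ, F') ∞ f x) :
    Function.Surjective (tderiv F F' f x) := by
  intro κ
  refine ⟨tderiv F F h.domChart.symm (h.domChart x)
    (h.equiv.symm (tderiv F' F' h.codChart (f x) κ, 0)), ?_⟩
  have h1 := tderiv_submersion h (h.equiv.symm (tderiv F' F' h.codChart (f x) κ, 0))
  rw [ContinuousLinearEquiv.apply_symm_apply] at h1
  have h2 := congrArg (tderiv F' F' h.codChart.symm (h.codChart (f x))) h1
  rwa [tderiv_symm_tderiv_chart h.codChart_mem_maximalAtlas h.mem_codChart_source,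
    tderiv_symm_tderiv_chart h.codChart_mem_maximalAtlas h.mem_codChart_source] at h2

/-- A vector in the kernel of the derivative of a submersion is the velocity of a curve in the
fiber. -/
lemma exists_curve_of_tderiv_submersion_eq_zero (h : IsSubmersionAt 𝓘(ℝ, F) 𝓘(ℝ, F') ∞ f x)
    {v : F} (hv : tderiv F F' f x v = 0) : ∃ c : ℝ → M, c 0 = x ∧
      ContMDiffAt 𝓘(ℝ, ℝ) 𝓘(ℝ, F) ∞ c 0 ∧ tderiv ℝ F c 0 1 = v ∧ ∀ᶠ r in 𝓝 0, f (c r) = f x := by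
  have hx := h.mem_domChart_source
  set e := h.domChart
  set u := tderiv F F e x v with hu
  have hvu : tderiv F F e.symm (e x) u = v :=
    tderiv_symm_tderiv_chart h.domChart_mem_maximalAtlas hx v
  have hu0 : (h.equiv u).1 = 0 := by
    rw [← tderiv_submersion h u, hvu, hv, map_zero]
  -- A line in the adapted chart: u has zero first component, so the projection, and with it f, is
  -- constant along the line.
  let y : ℝ → F := fun r => e x + r • u
  have hy0 : y 0 = e x := by simp [y]
  have hyd : HasDerivAt y u 0 := by
    have := ((hasDerivAt_id (0 : ℝ)).smul_const u).const_add (e x)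
    rwa [one_smul] at this
  have hys : ContDiff ℝ ∞ y := by fun_prop
  have hes : ContMDiffAt 𝓘(ℝ, F) 𝓘(ℝ, F) ∞ e.symm (y 0) := by
    rw [hy0]
    exact (contMDiffOn_symm_of_mem_maximalAtlas h.domChart_mem_maximalAtlas).contMDiffAt
      (e.open_target.mem_nhds (e.map_source hx))
  refine ⟨e.symm ∘ y, ?_, ?_, ?_, ?_⟩
  · simp only [Function.comp_apply, hy0, e.left_inv hx]
  · exact hes.comp 0 hys.contDiffAt.contMDiffAt
  · rw [tderiv_comp_apply hy0 (by rw [← hy0]; exact hes.mdifferentiableAt (by simp))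
      hyd.differentiableAt.mdifferentiableAt, tderiv_eq_fderiv, hyd.hasFDerivAt.fderiv]
    simpa using hvu
  · have ht : e.target ∈ 𝓝 (y 0) := by
      rw [hy0]
      exact e.open_target.mem_nhds (e.map_source hx)
    filter_upwards [hyd.continuousAt ht] with r hr
    have hw : ∀ z ∈ e.target, h.codChart (f (e.symm z)) = (h.equiv z).1 := fun z hz => by
      have := h.writtenInCharts
        (show z ∈ (h.domChart.extend 𝓘(ℝ, F)).target by simpa [e] using hz)
      simpa using this
    have h1 := hw (y r) hr
    have h2 := hw (e x) (e.map_source hx)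
    have h3 : (h.equiv (y r)).1 = (h.equiv (e x)).1 := by
      simp [y, hu0]
    rw [e.left_inv hx] at h2
    refine h.codChart.injOn (h.source_subset_preimage_source (e.map_target hr))
      h.mem_codChart_source ?_
    exact h1.trans (h3.trans h2.symm)

/-- In adapted charts the map is u ↦ (u, 0) up to a linear isomorphism. -/
lemma tderiv_immersion_injective (h : IsImmersionAt 𝓘(ℝ, F) 𝓘(ℝ, F') ∞ f x) :
    Function.Injective (tderiv F F' f x) := by
  have hd := openPartialHomeomorph_mdifferentiable h.domChart_mem_maximalAtlas
  have hc := openPartialHomeomorph_mdifferentiable h.codChart_mem_maximalAtlas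
  have hx := h.mem_domChart_source
  have hdx := hd.mdifferentiableAt_symm (h.domChart.map_source hx)
  have hf : MDifferentiableAt 𝓘(ℝ, F) 𝓘(ℝ, F') f x := h.contMDiffAt.mdifferentiableAt (by simp)
  have hl := h.domChart.left_inv hx
  have hfd : MDifferentiableAt 𝓘(ℝ, F) 𝓘(ℝ, F') (f ∘ h.domChart.symm) (h.domChart x) :=
    MDifferentiableAt.comp _ (by rwa [hl]) hdx
  have hfl : (f ∘ h.domChart.symm) (h.domChart x) = f x := congrArg f hl
  have key : ∀ u, tderiv F' F' h.codChart (f x)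
      (tderiv F F' f x (tderiv F F h.domChart.symm (h.domChart x) u)) = h.equiv (u, 0) := by
    intro u
    rw [← tderiv_comp_apply hl hf hdx,
      ← tderiv_comp_apply hfl (hc.mdifferentiableAt h.mem_codChart_source) hfd]
    have hev : h.codChart ∘ f ∘ h.domChart.symm =ᶠ[𝓝 (h.domChart x)] fun u => h.equiv (u, 0) := by
      filter_upwards [h.domChart.open_target.mem_nhds (h.domChart.map_source hx)] with z hz
      have := h.writtenInCharts
        (show z ∈ (h.domChart.extend 𝓘(ℝ, F)).target by simpa using hz)
      simpa using this
    rw [tderiv_congr hev, tderiv_eq_fderiv]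
    have : HasFDerivAt (fun u => h.equiv (u, 0))
        ((h.equiv : F × h.complement →L[ℝ] F').comp (ContinuousLinearMap.inl ℝ F h.complement))
        (h.domChart x) :=
      ((h.equiv : F × h.complement →L[ℝ] F').comp
        (ContinuousLinearMap.inl ℝ F h.complement)).hasFDerivAt
    rw [this.fderiv]
    rfl
  rw [injective_iff_map_eq_zero]
  intro v hv
  have h1 := key (tderiv F F h.domChart x v)
  rw [tderiv_symm_tderiv_chart h.domChart_mem_maximalAtlas hx, hv, map_zero] at h1
  have h2 : (tderiv F F h.domChart x v, (0 : h.complement)) = 0 :=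
    h.equiv.injective (by rw [← h1, map_zero])
  rw [← tderiv_symm_tderiv_chart h.domChart_mem_maximalAtlas hx v,
    show tderiv F F h.domChart x v = 0 from congrArg Prod.fst h2]
  exact map_zero _

end Immersion

/-! ### The exact sequence 𝔫 → 𝔤 → 𝔨 and the action of G on 𝔫 -/

section Extension

variable {E : Type u} {EN : Type v} {EK : Type z} {G : Type w}
  [NormedAddCommGroup E] [NormedSpace ℝ E] [NormedAddCommGroup EN] [NormedSpace ℝ EN]
  [NormedAddCommGroup EK] [NormedSpace ℝ EK]
  [TopologicalSpace G] [Group G] [ChartedSpace E G]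
  {N : Subgroup G} [ChartedSpace EN N]

variable (E EN N) in
/-- The inclusion `𝔫 → 𝔤`, on the model spaces. -/
def modelIncl : EN →L[ℝ] E := tderiv EN E (Subtype.val : N → G) 1

variable (E EN N) in
/-- The generator `η ↦ η g`, on the model spaces. -/
def modelVert (g : G) : EN →L[ℝ] E := tderiv EN E (fun n : N => (n : G) * g) 1

lemma mdifferentiable_val [hN : IsEmbeddedLieSubgroup E EN N] :
    MDifferentiable 𝓘(ℝ, EN) 𝓘(ℝ, E) (Subtype.val : N → G) :=
  hN.isSmoothEmbedding.contMDiff.mdifferentiable (by simp)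

lemma modelVert_one : modelVert E EN N 1 = modelIncl E EN N := by
  have h : (fun n : N => (n : G) * 1) = Subtype.val := by
    ext n
    simp
  rw [modelVert, h, modelIncl]

lemma modelIncl_injective [hN : IsEmbeddedLieSubgroup E EN N] :
    Function.Injective (modelIncl E EN N) :=
  tderiv_immersion_injective (hN.isSmoothEmbedding.isImmersion.isImmersionAt 1)

lemma modelIncl_modelBracket [IsEmbeddedLieSubgroup E EN N] [LieGroup 𝓘(ℝ, E) ∞ G]
    [LieGroup 𝓘(ℝ, EN) ∞ N] (η ξ : EN) :
    modelIncl E EN N (modelBracket N η ξ) =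
      modelBracket G (modelIncl E EN N η) (modelIncl E EN N ξ) :=
  tderiv_modelBracket N.subtype (mdifferentiable_val (1 : N)) η ξ

variable [N.Normal]

variable (EN N) in
/-- `Ad_g : 𝔫 → 𝔫`, on the model space. -/
def modelAd (g : G) : EN →L[ℝ] EN :=
  tderiv EN EN (fun n : N => MulAut.conjNormal g n) 1

variable (E EK N) in
/-- The projection `𝔤 → 𝔨`, on the model spaces. -/
def modelProj [ChartedSpace EK (G ⧸ N)] : E →L[ℝ] EK :=
  tderiv E EK (fun g : G => (g : G ⧸ N)) 1

section Ideal

variable [LieGroup 𝓘(ℝ, E) ∞ G]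

lemma modelAd_mul (hN : IsEmbeddedLieSubgroup E EN N) (g h : G) (η : EN) :
    modelAd EN N (g * h) η = modelAd EN N g (modelAd EN N h η) := lieAd_mul hN g h η

omit [LieGroup 𝓘(ℝ, E) ∞ G] in
lemma modelAd_one : modelAd EN N 1 = ContinuousLinearMap.id ℝ EN := lieAd_one

lemma modelAd_modelAd_inv (hN : IsEmbeddedLieSubgroup E EN N) (g : G) (η : EN) :
    modelAd EN N g (modelAd EN N g⁻¹ η) = η := by
  rw [← modelAd_mul hN, mul_inv_cancel, modelAd_one]
  rfl

lemma modelAd_inv_modelAd (hN : IsEmbeddedLieSubgroup E EN N) (g : G) (η : EN) :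
    modelAd EN N g⁻¹ (modelAd EN N g η) = η := by
  rw [← modelAd_mul hN, inv_mul_cancel, modelAd_one]
  rfl

/-- Conjugation on N is the restriction of conjugation on G; thus `Ad` on 𝔫 can be differentiated
inside 𝔤. -/
lemma modelIncl_modelAd [hN : IsEmbeddedLieSubgroup E EN N] (g : G) (η : EN) :
    modelIncl E EN N (modelAd EN N g η) =
      tderiv E E (fun x : G => g * x * g⁻¹) 1 (modelIncl E EN N η) := by
  have hd : MDifferentiable 𝓘(ℝ, EN) 𝓘(ℝ, EN) (fun n : N => MulAut.conjNormal g n) :=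
    (contMDiff_conj hN g).mdifferentiable (by simp)
  have h1 := tderiv_comp_apply (F := EN) (F' := EN) (F'' := E) (map_one (MulAut.conjNormal g))
    (mdifferentiable_val (1 : N)) (hd 1) η
  have h2 := tderiv_comp_apply (F := EN) (F' := E) (F'' := E) (Subgroup.coe_one N)
    (mdifferentiable_conj g 1) (mdifferentiable_val (1 : N)) η
  refine h1.symm.trans (Eq.trans ?_ h2)
  congr 2

/-- From n g = g (g⁻¹ n g). Normality of N makes the vertical space at g the left translate of 𝔫. -/
lemma modelVert_eq_leftD [hN : IsEmbeddedLieSubgroup E EN N] (g : G) (η : EN) :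
    modelVert E EN N g η = leftD g (modelIncl E EN N (modelAd EN N g⁻¹ η)) := by
  have h2 := tderiv_comp_apply (F := EN) (F' := E) (F'' := E) (Subgroup.coe_one N)
    (g := (fun x : G => g * x) ∘ fun x : G => g⁻¹ * x * g⁻¹⁻¹)
    ((mdifferentiable_mul_left g _).comp _ (mdifferentiable_conj g⁻¹ 1))
    (mdifferentiable_val (1 : N)) η
  rw [modelIncl_modelAd, leftD, ← tderiv_comp_apply (F := E) (x := (1 : G)) (by simp)
    (mdifferentiable_mul_left g 1) (mdifferentiable_conj g⁻¹ 1)]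
  refine Eq.trans ?_ h2
  rw [modelVert]
  congr 2
  ext n
  simp [mul_assoc]

lemma modelVert_injective [hN : IsEmbeddedLieSubgroup E EN N] (g : G) :
    Function.Injective (modelVert E EN N g) := by
  intro η ξ h
  rw [modelVert_eq_leftD, modelVert_eq_leftD] at h
  exact Function.LeftInverse.injective (modelAd_modelAd_inv hN g)
    (modelIncl_injective (leftD_injective g h))

end Ideal

section Projection

variable [ChartedSpace EK (G ⧸ N)]
  (hπ : IsSubmersion 𝓘(ℝ, E) 𝓘(ℝ, EK) ∞ (fun g : G => (g : G ⧸ N)))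

include hπ

lemma mdifferentiable_mk : MDifferentiable 𝓘(ℝ, E) 𝓘(ℝ, EK) (QuotientGroup.mk' N) :=
  hπ.contMDiff.mdifferentiable (by simp)

omit [N.Normal] in
lemma modelProj_surjective : Function.Surjective (modelProj E EK N) :=
  tderiv_submersion_surjective (hπ.isSubmersionAt 1)

lemma modelProj_modelIncl [IsEmbeddedLieSubgroup E EN N] (η : EN) :
    modelProj E EK N (modelIncl E EN N η) = 0 := by
  have h1 := tderiv_comp_apply (F := EN) (F' := E) (F'' := EK) (Subgroup.coe_one N)
    (mdifferentiable_mk hπ 1) (mdifferentiable_val (1 : N)) η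
  have h2 : QuotientGroup.mk' N ∘ (Subtype.val : N → G) = fun _ => 1 := by
    ext n
    simp
  rw [h2, tderiv_const] at h1
  exact h1.symm

/-- The kernel of `𝔤 → 𝔨` is contained in `𝔫`. -/
lemma exists_modelIncl_eq [hN : IsEmbeddedLieSubgroup E EN N] {v : E}
    (hv : modelProj E EK N v = 0) : ∃ η : EN, modelIncl E EN N η = v := by
  classical
  obtain ⟨c, hc0, hc, hcv, hcN⟩ :=
    exists_curve_of_tderiv_submersion_eq_zero (hπ.isSubmersionAt 1) hv
  have hmem : ∀ᶠ r in 𝓝 (0 : ℝ), c r ∈ N := by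
    filter_upwards [hcN] with r hr
    rwa [QuotientGroup.mk_one, QuotientGroup.eq_one_iff] at hr
  -- The curve c regarded in N. The value 1 is a default that does not occur near 0.
  let d : ℝ → N := fun r => if h : c r ∈ N then ⟨c r, h⟩ else 1
  have hd : Subtype.val ∘ d =ᶠ[𝓝 0] c := by
    filter_upwards [hmem] with r hr
    simp [d, hr]
  have hd0 : d 0 = 1 := Subtype.ext (hd.eq_of_nhds.trans hc0)
  have hds : ContMDiffAt 𝓘(ℝ, ℝ) 𝓘(ℝ, E) ∞ (Subtype.val ∘ d) 0 := hc.congr_of_eventuallyEq hd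
  -- Smoothness into G descends to N: the topological embedding gives continuity of d, and the
  -- immersion gives the rest.
  have hdm : ContMDiffAt 𝓘(ℝ, ℝ) 𝓘(ℝ, EN) ∞ d 0 := by
    rw [ContMDiffAt.iff_comp_isImmersionAt
      (hN.isSmoothEmbedding.isImmersion.isImmersionAt (d 0))]
    refine ⟨?_, hds⟩
    rw [hN.isSmoothEmbedding.isEmbedding.isInducing.continuousAt_iff]
    exact hds.continuousAt
  refine ⟨tderiv ℝ EN d 0 1, ?_⟩
  rw [← hcv, ← tderiv_congr hd]
  exact (tderiv_comp_apply hd0 (mdifferentiable_val (1 : N)) (hdm.mdifferentiableAt (by simp))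
    (1 : ℝ)).symm

lemma modelProj_modelBracket [LieGroup 𝓘(ℝ, E) ∞ G] [LieGroup 𝓘(ℝ, EK) ∞ (G ⧸ N)] (v w : E) :
    modelProj E EK N (modelBracket G v w) =
      modelBracket (G ⧸ N) (modelProj E EK N v) (modelProj E EK N w) :=
  tderiv_modelBracket (QuotientGroup.mk' N) (mdifferentiable_mk hπ 1) v w

end Projection

end Extension

/-! ### Vertical parts and horizontal lifts -/

section Metric

variable {E : Type u} {EN : Type v} {EK : Type z} {G : Type w}
  [NormedAddCommGroup E] [NormedSpace ℝ E] [NormedAddCommGroup EN] [NormedSpace ℝ EN]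
  [NormedAddCommGroup EK] [NormedSpace ℝ EK]
  [TopologicalSpace G] [Group G] [ChartedSpace E G] [LieGroup 𝓘(ℝ, E) ∞ G]
  {N : Subgroup G} [ChartedSpace EN N] (μ : Metric E G)

/-- The metric, on the model space. -/
def modelInner (g : G) : E →L[ℝ] E →L[ℝ] ℝ := μ.inner g

variable (EN N) in
/-- The horizontal space at `g`, in the model space. -/
def modelHorizontal (g : G) : Submodule ℝ E := horizontal EN N μ g

variable {μ}

lemma mem_modelHorizontal {g : G} {v : E} : v ∈ modelHorizontal EN N μ g ↔
    ∀ η : EN, modelInner μ g v (modelVert E EN N g η) = 0 := Iff.rfl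

lemma eq_zero_of_modelInner_self {g : G} {v : E} (h : modelInner μ g v v = 0) : v = 0 := by
  by_contra hv
  exact (μ.pos g v hv).ne' h

lemma modelInner_leftD (hμ : IsInvariantMetric μ) (g : G) (v w : E) :
    modelInner μ g (leftD g v) (leftD g w) = modelInner μ 1 v w := by
  -- Invariance is stated at `g * 1`, so the base point has to be moved to `g`.
  have h : ∀ h : G, h = g → modelInner μ h (leftD g v) (leftD g w) =
      modelInner μ g (leftD g v) (leftD g w) := by
    rintro _ rfl
    rfl
  exact (h (g * 1) (mul_one g)).symm.trans (hμ g 1 v w)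

/-- Every tangent vector has a unique vertical part. -/
lemma existsUnique_vertical_part [FiniteDimensional ℝ EN] (g : G)
    (hg : Function.Injective (modelVert E EN N g)) (v : E) :
    ∃! η : EN, v - modelVert E EN N g η ∈ modelHorizontal EN N μ g := by
  set V := modelVert E EN N g
  -- The Gram form of the metric on vertical vectors is positive definite, hence an isomorphism of 𝔫
  -- with its dual. The vertical part of v represents ξ ↦ ⟨v, ξ g⟩.
  let T : EN →ₗ[ℝ] EN →ₗ[ℝ] ℝ :=
    LinearMap.mk₂ ℝ (fun η ξ => modelInner μ g (V η) (V ξ)) (by simp) (by simp) (by simp) (by simp)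
  have hT : Function.Injective T := by
    rw [injective_iff_map_eq_zero]
    intro η hη
    have h1 : modelInner μ g (V η) (V η) = 0 := congrArg (fun L => L η) hη
    exact hg ((eq_zero_of_modelInner_self h1).trans (map_zero V).symm)
  have hTs : Function.Surjective T :=
    (LinearMap.injective_iff_surjective_of_finrank_eq_finrank Subspace.dual_finrank_eq.symm).1 hT
  have key : ∀ η : EN, v - V η ∈ modelHorizontal EN N μ g ↔
      T η = ((modelInner μ g v).comp V : EN →L[ℝ] ℝ) := fun η => by
    rw [LinearMap.ext_iff, mem_modelHorizontal]
    refine forall_congr' fun ξ => ?_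
    rw [map_sub, sub_apply, sub_eq_zero]
    exact eq_comm
  obtain ⟨η, hη⟩ := hTs ((modelInner μ g v).comp V : EN →L[ℝ] ℝ)
  exact ⟨η, (key η).2 hη, fun ξ hξ => hT (((key ξ).1 hξ).trans hη.symm)⟩

variable [N.Normal]

/-- Left translation is isometric and carries 𝔫 onto the vertical space at g, so it carries H(e)
onto H(g). -/
lemma leftD_mem_modelHorizontal [hN : IsEmbeddedLieSubgroup E EN N] (hμ : IsInvariantMetric μ)
    {g : G} {v : E} : leftD g v ∈ modelHorizontal EN N μ g ↔ v ∈ modelHorizontal EN N μ 1 := by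
  rw [mem_modelHorizontal, mem_modelHorizontal]
  simp only [modelVert_eq_leftD g, modelInner_leftD hμ, modelVert_one]
  exact ⟨fun h η => by simpa only [modelAd_inv_modelAd hN] using h (modelAd EN N g η),
    fun h η => h _⟩

/-- Every vector of `𝔨` has a unique horizontal lift. -/
lemma existsUnique_horizontal_lift [FiniteDimensional ℝ EN] [hN : IsEmbeddedLieSubgroup E EN N]
    [ChartedSpace EK (G ⧸ N)] (hπ : IsSubmersion 𝓘(ℝ, E) 𝓘(ℝ, EK) ∞ (fun g : G => (g : G ⧸ N)))
    (κ : EK) : ∃! v : E, v ∈ modelHorizontal EN N μ 1 ∧ modelProj E EK N v = κ := by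
  obtain ⟨v, hv⟩ := modelProj_surjective hπ κ
  obtain ⟨η, hη, -⟩ := existsUnique_vertical_part (μ := μ) (1 : G)
    (modelVert_injective (N := N) (EN := EN) 1) v
  rw [modelVert_one] at hη
  refine ⟨v - modelIncl E EN N η, ⟨hη, ?_⟩, ?_⟩
  · rw [map_sub, modelProj_modelIncl hπ, sub_zero, hv]
  · rintro u ⟨hu, huκ⟩
    -- The difference of two lifts lies in 𝔫 and is horizontal, so it is orthogonal to itself.
    obtain ⟨ξ, hξ⟩ := exists_modelIncl_eq (EN := EN) hπ
      (v := u - (v - modelIncl E EN N η)) (by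
        rw [map_sub, map_sub, modelProj_modelIncl hπ, huκ, hv, sub_zero, sub_self])
    have h1 := mem_modelHorizontal.1 (sub_mem hu hη) ξ
    rw [modelVert_one, hξ] at h1
    exact sub_eq_zero.1 (eq_zero_of_modelInner_self h1)

end Metric

/-- Turns the choices in `connForm` and `horLift` into characterizations by their defining
properties. -/
lemma epsilon_eq_iff {α : Type*} [Nonempty α] {p : α → Prop} (h : ∃! a, p a) (a : α) :
    Classical.epsilon p = a ↔ p a := by
  have h1 : p (Classical.epsilon p) := Classical.epsilon_spec h.exists
  exact ⟨fun e => e ▸ h1, fun ha => h.unique h1 ha⟩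

/-! ### The splitting 𝔤 = 𝔨 ⊕ 𝔫 and its bracket -/

section BracketFormula

variable {E : Type u} {EN : Type v} {EK : Type z} {G : Type w}
  [NormedAddCommGroup E] [NormedSpace ℝ E] [NormedAddCommGroup EN] [NormedSpace ℝ EN]
  [FiniteDimensional ℝ EN] [NormedAddCommGroup EK] [NormedSpace ℝ EK]
  [TopologicalSpace G] [Group G] [ChartedSpace E G] [LieGroup 𝓘(ℝ, E) ∞ G]
  {N : Subgroup G} [ChartedSpace EN N] {μ : Metric E G}

/-- The regularity under which `GroupLieAlgebra` is a Lie ring. -/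
instance [CompleteSpace E] : LieGroup 𝓘(ℝ, E) (minSmoothness ℝ 3) G := by
  rw [minSmoothness_of_isRCLikeNormedField]
  infer_instance

lemma connForm_eq_iff [N.Normal] [IsEmbeddedLieSubgroup E EN N]
    (g : G) (v : TangentSpace 𝓘(ℝ, E) g) (η : GroupLieAlgebra 𝓘(ℝ, EN) N) :
    connForm EN N μ g v = η ↔ v - vertGen E EN N g η ∈ horizontal EN N μ g :=
  epsilon_eq_iff (existsUnique_vertical_part (E := E) g (modelVert_injective (EN := EN) g) v) η

variable (EN N μ) in
/-- The connection form at `e`, on the model spaces. -/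
def modelConn (v : E) : EN := connForm EN N μ (1 : G) v

lemma modelConn_spec [N.Normal] [IsEmbeddedLieSubgroup E EN N] (v : E) :
    v - modelIncl E EN N (modelConn EN N μ v) ∈ modelHorizontal EN N μ 1 := by
  have h : v - modelVert E EN N 1 (modelConn EN N μ v) ∈ modelHorizontal EN N μ 1 :=
    (connForm_eq_iff (1 : G) v _).1 rfl
  rwa [modelVert_one] at h

variable [N.Normal] [ChartedSpace EK (G ⧸ N)]

section

variable (EN N μ) in
/-- The horizontal lift of `κ`, on the model spaces. -/
def modelLift (κ : EK) : E := horLift (EK := EK) (N := N) EN μ κ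

variable (N μ) in
/-- The map `b_N`, on the model spaces. -/
def modelB (κ : EK) (η : EN) : EN := bForm (EK := EK) (EN := EN) (N := N) μ κ η

variable (EN N μ) in
/-- The map `a_N`, on the model spaces. -/
def modelA (κ κ' : EK) : EN := aForm (EK := EK) (N := N) EN μ κ κ'

variable [hN : IsEmbeddedLieSubgroup E EN N]
  (hπ : IsSubmersion 𝓘(ℝ, E) 𝓘(ℝ, EK) ∞ (fun g : G => (g : G ⧸ N)))

include hπ

lemma modelLift_eq_iff (κ : EK) (v : E) :
    modelLift EN N μ κ = v ↔ v ∈ modelHorizontal EN N μ 1 ∧ modelProj E EK N v = κ :=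
  epsilon_eq_iff (existsUnique_horizontal_lift hπ κ) v

lemma modelLift_mem (κ : EK) : modelLift EN N μ κ ∈ modelHorizontal EN N μ 1 :=
  ((modelLift_eq_iff hπ κ _).1 rfl).1

lemma modelProj_modelLift (κ : EK) : modelProj E EK N (modelLift EN N μ κ) = κ :=
  ((modelLift_eq_iff hπ κ _).1 rfl).2

variable (EN μ) in
/-- The horizontal lift as a linear map. -/
def modelLiftₗ : EK →ₗ[ℝ] E where
  toFun := modelLift EN N μ
  map_add' κ κ' := (modelLift_eq_iff hπ _ _).2
    ⟨add_mem (modelLift_mem hπ κ) (modelLift_mem hπ κ'), by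
      rw [map_add, modelProj_modelLift hπ, modelProj_modelLift hπ]⟩
  map_smul' c κ := (modelLift_eq_iff hπ _ _).2
    ⟨Submodule.smul_mem _ c (modelLift_mem hπ κ), by
      rw [map_smul, modelProj_modelLift hπ]; rfl⟩

variable (EN μ) in
/-- The isomorphism `𝔨 ⊕ 𝔫 → 𝔤`, `κ ⊕ η ↦ κ^{A_N} + η`. -/
def splitting : (EK × EN) ≃ₗ[ℝ] E :=
  LinearEquiv.ofBijective
    ((modelLiftₗ EN μ hπ).coprod (modelIncl E EN N : EN →ₗ[ℝ] E)) (by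
    have key : ∀ p : EK × EN, ((modelLiftₗ EN μ hπ).coprod (modelIncl E EN N : EN →ₗ[ℝ] E)) p =
        modelLift EN N μ p.1 + modelIncl E EN N p.2 := fun p => rfl
    constructor
    · rw [injective_iff_map_eq_zero]
      rintro ⟨κ, η⟩ h
      rw [key] at h
      have h1 := congrArg (modelProj E EK N) h
      rw [map_add, modelProj_modelLift hπ, modelProj_modelIncl hπ, add_zero, map_zero] at h1
      change κ = 0 at h1
      subst h1
      rw [show modelLift EN N μ (0 : EK) = 0 from map_zero (modelLiftₗ EN μ hπ), zero_add] at h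
      have h2 : η = 0 := modelIncl_injective (h.trans (map_zero _).symm)
      rw [h2]
      rfl
    · intro v
      -- v - A(v) is horizontal over the projection of v, so it is the lift of that projection.
      refine ⟨(modelProj E EK N v, modelConn EN N μ v), ?_⟩
      rw [key, (modelLift_eq_iff hπ _ _).2 ⟨modelConn_spec v, by
        rw [map_sub, modelProj_modelIncl hπ, sub_zero]⟩]
      exact sub_add_cancel _ _)

lemma splitting_apply (κ : EK) (η : EN) :
    splitting EN μ hπ (κ, η) = modelLift EN N μ κ + modelIncl E EN N η := rfl

end

variable [CompleteSpace E] [CompleteSpace EK] [LieGroup 𝓘(ℝ, EN) ∞ N]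
  [LieGroup 𝓘(ℝ, EK) ∞ (G ⧸ N)] [hN : IsEmbeddedLieSubgroup E EN N]
  (hπ : IsSubmersion 𝓘(ℝ, E) 𝓘(ℝ, EK) ∞ (fun g : G => (g : G ⧸ N)))

include hπ

omit [LieGroup 𝓘(ℝ, EN) ∞ N] [FiniteDimensional ℝ EN] [CompleteSpace E] in
/-- `[κ^{A_N}, η]` lies in `𝔫`. -/
lemma modelIncl_modelB (κ : EK) (η : EN) :
    modelIncl E EN N (modelB N μ κ η) =
      modelBracket G (modelLift EN N μ κ) (modelIncl E EN N η) := by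
  -- The projection preserves brackets and kills η, so the bracket lies in its kernel, which is 𝔫.
  have h0 : modelProj E EK N (modelBracket G (modelLift EN N μ κ) (modelIncl E EN N η)) = 0 := by
    rw [modelProj_modelBracket hπ, modelProj_modelIncl hπ]
    exact lie_zero (L := GroupLieAlgebra 𝓘(ℝ, EK) (G ⧸ N)) (M := GroupLieAlgebra 𝓘(ℝ, EK) (G ⧸ N)) _
  exact Classical.epsilon_spec (p := fun ξ : EN => modelIncl E EN N ξ =
    modelBracket G (modelLift EN N μ κ) (modelIncl E EN N η)) (exists_modelIncl_eq hπ h0)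

omit [LieGroup 𝓘(ℝ, EN) ∞ N] [CompleteSpace E] [CompleteSpace EK] in
-- The bracket of the lifts projects to [κ, κ'], which determines its horizontal part; its vertical
-- part is -a_N by definition.
lemma modelBracket_modelLift (κ κ' : EK) :
    modelBracket G (modelLift EN N μ κ) (modelLift EN N μ κ') =
      modelLift EN N μ (modelBracket (G ⧸ N) κ κ') -
        modelIncl E EN N (modelA EN N μ κ κ') := by
  set v := modelBracket G (modelLift EN N μ κ) (modelLift EN N μ κ') with hv
  have h1 : modelA EN N μ κ κ' = -modelConn EN N μ v := rfl
  rw [h1, map_neg, sub_neg_eq_add, (modelLift_eq_iff hπ _ _).2 ⟨modelConn_spec v, ?_⟩]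
  · exact (sub_add_cancel _ _).symm
  · rw [map_sub, modelProj_modelIncl hπ, sub_zero, hv, modelProj_modelBracket hπ,
      modelProj_modelLift hπ, modelProj_modelLift hπ]

/-- The bracket of `𝔤` in the decomposition `𝔤 = 𝔨 ⊕ 𝔫`. -/
theorem modelBracket_splitting (κ κ' : EK) (η η' : EN) :
    modelBracket G (splitting EN μ hπ (κ, η)) (splitting EN μ hπ (κ', η')) =
      splitting EN μ hπ (modelBracket (G ⧸ N) κ κ',
        modelB N μ κ η' - modelB N μ κ' η - modelA EN N μ κ κ' + modelBracket N η η') := by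
  -- The term [b, c] is written -[c, b], so that both mixed terms have the form of b_N.
  have expand : ∀ a b c d : E, modelBracket G (a + b) (c + d) =
      modelBracket G a c + modelBracket G a d - modelBracket G c b + modelBracket G b d := by
    intro a b c d
    have h : ∀ a b c d : GroupLieAlgebra 𝓘(ℝ, E) G,
        ⁅a + b, c + d⁆ = ⁅a, c⁆ + ⁅a, d⁆ - ⁅c, b⁆ + ⁅b, d⁆ := by
      intro a b c d
      rw [add_lie, lie_add, lie_add, ← lie_skew b c]
      abel
    exact h a b c d
  simp only [splitting_apply]
  rw [expand, modelBracket_modelLift hπ, ← modelIncl_modelB hπ, ← modelIncl_modelB hπ,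
    ← modelIncl_modelBracket, map_add, map_sub, map_sub]
  abel

end BracketFormula

/-! ### Horizontal lifts, parallel transport and the covariant derivative -/

section Transport

variable {E : Type u} {EN : Type v} {EK : Type z} {G : Type w}
  [NormedAddCommGroup E] [NormedSpace ℝ E] [NormedAddCommGroup EN] [NormedSpace ℝ EN]
  [FiniteDimensional ℝ EN] [NormedAddCommGroup EK] [NormedSpace ℝ EK]
  [TopologicalSpace G] [Group G] [ChartedSpace E G] [LieGroup 𝓘(ℝ, E) ∞ G]
  {N : Subgroup G} [N.Normal] [ChartedSpace EN N] [hN : IsEmbeddedLieSubgroup E EN N]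
  {μ : Metric E G}

section Fiber

variable (E EN) in
/-- The element `[g, η]_N` of the fiber over `k`, for `g` over `k`. -/
def fiberAt {k : G ⧸ N} (g : G) (hg : (g : G ⧸ N) = k) (η : EN) : AdjFiber E EN k :=
  ⟨adjMk E EN g η, hg⟩

omit [FiniteDimensional ℝ EN] in
-- Lets difference quotients in a fiber be computed in 𝔫, once all classes have the same
-- representative g.
lemma fiberAt_smul_sub {k : G ⧸ N} (g : G) (hg : (g : G ⧸ N) = k) (c : ℝ) (η ξ : EN) :
    fiberAt E EN g hg (c • (η - ξ)) = c • (fiberAt E EN g hg η - fiberAt E EN g hg ξ) := by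
  subst hg
  have h1 : fiberMk E EN (N := N) g (η - ξ) = fiberMk E EN g η - fiberMk E EN g ξ :=
    eq_sub_iff_add_eq.2 ((fiberMk_add E EN g (η - ξ) ξ).symm.trans
      (congrArg (fiberMk E EN g) (sub_add_cancel η ξ)))
  exact (fiberMk_smul E EN g c (η - ξ)).trans (congrArg _ h1)

omit [FiniteDimensional ℝ EN] in
lemma isHomeomorph_fiberAt {k : G ⧸ N} (g : G) (hg : (g : G ⧸ N) = k) :
    IsHomeomorph (fiberAt E EN g hg) := by
  subst hg
  exact isHomeomorph_fiberMk E EN g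

/-- Needed for the uniqueness of the limit that defines the covariant derivative. -/
instance (k : G ⧸ N) : T2Space (AdjFiber E EN k) :=
  (isHomeomorph_fiberAt (E := E) (EN := EN) k.out (QuotientGroup.out_eq' k)).homeomorph.t2Space

omit [FiniteDimensional ℝ EN] in
lemma invSection_eq_fiberAt {k : G ⧸ N} (g : G) (hg : (g : G ⧸ N) = k) (η : EN) :
    invSection E EN η k = fiberAt E EN g hg (modelAd EN N g η) := by
  subst hg
  rfl

end Fiber

variable [ChartedSpace EK (G ⧸ N)] [LieGroup 𝓘(ℝ, EK) ∞ (G ⧸ N)]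
  (hπ : IsSubmersion 𝓘(ℝ, E) 𝓘(ℝ, EK) ∞ (fun g : G => (g : G ⧸ N)))

include hπ

/-- The logarithmic derivative of a horizontal curve is the horizontal lift of that of its
projection. -/
lemma logDeriv_eq_modelLift (hμ : IsInvariantMetric μ) {q : ℝ → G} {t : ℝ} {ξ : E} {κ : EK}
    (hq : HasLogDerivAt q ξ t) (hh : tderiv ℝ E q t 1 ∈ modelHorizontal EN N μ (q t))
    (hκ : HasLogDerivAt (fun s => (q s : G ⧸ N)) κ t) : ξ = modelLift EN N μ κ := by
  rw [hq.tderiv_eq, leftD_mem_modelHorizontal hμ] at hh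
  exact ((modelLift_eq_iff hπ κ ξ).2
    ⟨hh, (hq.map (QuotientGroup.mk' N) (mdifferentiable_mk hπ)).unique hκ⟩).symm

/-- Horizontal lifts are unique up to translation by an element of `N`. -/
lemma IsHorizontalLift.exists_eq_mul (hμ : IsInvariantMetric μ) {x : ℝ → G ⧸ N} {a b : ℝ}
    {q p : ℝ → G} (hq : IsHorizontalLift EN μ x a b q) (hp : IsHorizontalLift EN μ x a b p) :
    ∃ n : N, ∀ t ∈ Set.uIcc a b, p t = n * q t := by
  have hqp : ∀ t ∈ Set.uIcc a b, (p t : G ⧸ N) = q t := fun t ht =>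
    ((hp t ht).2.1).trans ((hq t ht).2.1).symm
  have hmem : p a * (q a)⁻¹ ∈ N := by
    rw [← QuotientGroup.eq_one_iff, QuotientGroup.mk_mul, QuotientGroup.mk_inv,
      hqp a Set.left_mem_uIcc, mul_inv_cancel]
  refine ⟨⟨_, hmem⟩, fun t ht => ?_⟩
  rw [← mul_inv_eq_iff_eq_mul]
  -- On a one-point interval derivatives within the interval are not unique, but there the claim is
  -- immediate.
  rcases eq_or_ne a b with rfl | hab
  · rw [Set.uIcc_self, Set.mem_singleton_iff] at ht
    rw [ht]
  have key : ∀ s ∈ Set.uIcc a b, MDifferentiableAt 𝓘(ℝ, ℝ) 𝓘(ℝ, E) (fun r => p r * (q r)⁻¹) s ∧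
      tderiv ℝ E (fun r => p r * (q r)⁻¹) s = 0 := by
    intro s hs
    obtain ⟨hq1, -, hq2⟩ := hq s hs
    obtain ⟨hp1, -, hp2⟩ := hp s hs
    obtain ⟨ξ, hξ⟩ := exists_hasLogDerivAt (hq1.mdifferentiableAt one_ne_zero)
    obtain ⟨ζ, hζ⟩ := exists_hasLogDerivAt (hp1.mdifferentiableAt one_ne_zero)
    have hξ' := hξ.map (QuotientGroup.mk' N) (mdifferentiable_mk hπ)
    have hζ' := hζ.map (QuotientGroup.mk' N) (mdifferentiable_mk hπ)
    -- The projections of p and q agree only on the closed interval. Comparing their derivatives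
    -- within it also covers the end points.
    have hud : UniqueMDiffWithinAt 𝓘(ℝ, ℝ) (Set.uIcc a b) s :=
      ((uniqueDiffOn_Icc (by simpa [eq_comm] using hab)) s hs).uniqueMDiffWithinAt
    have h1 : mfderivWithin 𝓘(ℝ, ℝ) 𝓘(ℝ, EK) (fun r => (p r : G ⧸ N)) (Set.uIcc a b) s =
        mfderivWithin 𝓘(ℝ, ℝ) 𝓘(ℝ, EK) (fun r => (q r : G ⧸ N)) (Set.uIcc a b) s :=
      mfderivWithin_congr (fun r hr => hqp r hr) (hqp s hs)
    have h2 : tderiv ℝ EK (fun r => (p r : G ⧸ N)) s = tderiv ℝ EK (fun r => (q r : G ⧸ N)) s :=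
      (mfderivWithin_eq_mfderiv hud hζ'.mdifferentiableAt).symm.trans
        (h1.trans (mfderivWithin_eq_mfderiv hud hξ'.mdifferentiableAt))
    have h3 : modelProj E EK N ζ = modelProj E EK N ξ := by
      apply leftD_injective ((q s : G ⧸ N))
      have e1 := hξ'.tderiv_eq
      have e2 := hζ'.tderiv_eq
      have e3 := congrArg (fun L : ℝ →L[ℝ] EK => L 1) h2
      simp only [QuotientGroup.mk'_apply, hqp s hs] at e1 e2 e3
      exact (e2.symm.trans e3).trans e1
    have h4 := logDeriv_eq_modelLift hπ hμ hξ hq2 hξ'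
    have h5 := logDeriv_eq_modelLift hπ hμ hζ hp2 hζ'
    have h6 : ζ = ξ := h5.trans ((congrArg (modelLift EN N μ) h3).trans h4.symm)
    -- Horizontal curves with the same projection have the same logarithmic derivative, so p q⁻¹ has
    -- derivative zero.
    exact hξ.tderiv_mul_inv (h6 ▸ hζ)
  exact eq_of_tderiv_eq_zero (F := E) (convex_uIcc a b) (fun s hs => (key s hs).1)
    (fun s hs => (key s hs).2) ht Set.left_mem_uIcc

/-- Parallel transport is single-valued. -/
lemma IsParallelTransport.unique (hμ : IsInvariantMetric μ) {x : ℝ → G ⧸ N} {a b : ℝ}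
    {c : AdjFiber E EN (x a)} {y y' : AdjFiber E EN (x b)}
    (h : IsParallelTransport μ x a b c y) (h' : IsParallelTransport μ x a b c y') : y = y' := by
  obtain ⟨q, m, hq, hc, hy⟩ := h
  obtain ⟨p, l, hp, hc', hy'⟩ := h'
  obtain ⟨n, hn⟩ := hq.exists_eq_mul hπ hμ hp
  -- [n q, l] = [q, Ad_{n⁻¹} l] with the same n at both ends, so both transports can be written
  -- along q.
  have e : ∀ t ∈ Set.uIcc a b, adjMk E EN (p t) l = adjMk E EN (q t) (lieAd EN N ((n : G)⁻¹) l) := by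
    intro t ht
    refine ((adjMk_eq_iff E EN).2 ⟨n, hn t ht, ?_⟩).symm
    exact (modelAd_modelAd_inv hN (n : G) l).symm
  have h1 : m = lieAd EN N ((n : G)⁻¹) l := by
    refine (bijective_adjMk E EN (x a) (q a) (hq a Set.left_mem_uIcc).2.1).1 (Subtype.ext ?_)
    exact hc.symm.trans (hc'.trans (e a Set.left_mem_uIcc))
  apply Subtype.ext
  rw [hy, hy', e b Set.right_mem_uIcc, h1]

/-- Covariant derivatives are unique. -/
lemma HasCovDerivAt.unique (hμ : IsInvariantMetric μ) {x : ℝ → G ⧸ N}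
    {c : ∀ t, AdjFiber E EN (x t)} {t : ℝ} {w w' : AdjFiber E EN (x t)}
    (h : HasCovDerivAt μ x c t w) (h' : HasCovDerivAt μ x c t w') : w = w' := by
  obtain ⟨T, hT, hw⟩ := h
  obtain ⟨T', hT', hw'⟩ := h'
  refine tendsto_nhds_unique hw (hw'.congr' ?_)
  filter_upwards [nhdsWithin_le_nhds hT, nhdsWithin_le_nhds hT'] with s h1 h2
  rw [h1.unique hπ hμ h2]

/-- Smooth curves have local horizontal lifts. -/
lemma exists_horizontal_lift [FiniteDimensional ℝ E] [FiniteDimensional ℝ EK] (hμ : IsInvariantMetric μ)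
    {x : ℝ → G ⧸ N} (hx : ContMDiff 𝓘(ℝ, ℝ) 𝓘(ℝ, EK) ∞ x) (t : ℝ) {κ : EK}
    (hκ : HasLogDerivAt x κ t) : ∃ q : ℝ → G, HasLogDerivAt q (modelLift EN N μ κ) t ∧
      (q t : G ⧸ N) = x t ∧ ∀ᶠ s in 𝓝 0, IsHorizontalLift EN μ x (t + s) t q := by
  obtain ⟨k, hk, hkx⟩ := exists_contDiff_hasLogDerivAt hx
  obtain ⟨g, hg⟩ := QuotientGroup.mk_surjective (x t)
  have hlift : ContDiffAt ℝ 1 (fun s => modelLift EN N μ (k s)) t :=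
    (LinearMap.toContinuousLinearMap (modelLiftₗ EN μ hπ)).contDiff.contDiffAt.comp t hk.contDiffAt
  -- Solves q⁻¹q' = (x⁻¹x')^A from a point over x(t).
  obtain ⟨q, hqt, hq⟩ := exists_hasLogDerivAt_eq (G := G) hlift g
  obtain ⟨ε, hε, hball⟩ := Metric.mem_nhds_iff.1 hq
  have htt : t ∈ Metric.ball t ε := Metric.mem_ball_self hε
  have hqx : ∀ s ∈ Metric.ball t ε, HasLogDerivAt (fun r => (q r : G ⧸ N)) (k s) s := by
    intro s hs
    have := (hball hs).2.map (QuotientGroup.mk' N) (mdifferentiable_mk hπ)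
    change HasLogDerivAt _ (modelProj E EK N (modelLift EN N μ (k s))) s at this
    rwa [modelProj_modelLift hπ] at this
  -- The projection of q has the logarithmic derivative of x and agrees with x at t, so the two
  -- coincide on the ball.
  have hproj : ∀ s ∈ Metric.ball t ε, (q s : G ⧸ N) = x s := by
    intro s hs
    have := eq_of_tderiv_eq_zero (F := EK) (convex_ball t ε)
      (fun r hr => ((hkx r).tderiv_mul_inv (hqx r hr)).1)
      (fun r hr => ((hkx r).tderiv_mul_inv (hqx r hr)).2) hs htt
    simp only [hqt, hg, mul_inv_cancel] at this
    exact mul_inv_eq_one.1 this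
  refine ⟨q, ?_, hproj t htt, ?_⟩
  · rw [hκ.unique (hkx t)]
    exact (hball htt).2
  · have h0 : ∀ᶠ s in 𝓝 (0 : ℝ), t + s ∈ Metric.ball t ε := by
      filter_upwards [Metric.ball_mem_nhds (0 : ℝ) hε] with s hs
      simpa [Metric.mem_ball, dist_eq_norm] using hs
    filter_upwards [h0] with s hs r hr
    have hr' : r ∈ Metric.ball t ε :=
      (convex_ball t ε).ordConnected.uIcc_subset hs htt hr
    obtain ⟨h1, h2⟩ := hball hr'
    refine ⟨h1, hproj r hr', ?_⟩
    have : tderiv ℝ E q r 1 ∈ modelHorizontal EN N μ (q r) := by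
      rw [h2.tderiv_eq, leftD_mem_modelHorizontal hμ]
      exact modelLift_mem hπ _
    exact this

omit [FiniteDimensional ℝ EN] in
/-- The derivative of `Ad η` along a curve with horizontal velocity. -/
lemma hasDerivAt_modelAd [FiniteDimensional ℝ E] [CompleteSpace EK] {q : ℝ → G} {t : ℝ} {κ : EK}
    (hq : HasLogDerivAt q (modelLift EN N μ κ) t) (η : EN) :
    HasDerivAt (fun r => modelAd EN N (q r) η) (modelAd EN N (q t) (modelB N μ κ η)) t := by
  -- The derivative of `Ad` is known in 𝔤. A linear left inverse of 𝔫 → 𝔤, continuous in finite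
  -- dimension, brings it back to 𝔫.
  obtain ⟨S, hS⟩ := (modelIncl E EN N : EN →ₗ[ℝ] E).exists_leftInverse_of_injective
    (LinearMap.ker_eq_bot.2 modelIncl_injective)
  have : CompleteSpace E := FiniteDimensional.complete ℝ E
  have h1 := (hq.hasVelocityAtOne).hasDerivAt_conj (modelIncl E EN N η)
  rw [← modelIncl_modelB hπ] at h1
  have h2 : HasDerivAt (fun r => modelIncl E EN N (modelAd EN N ((q t)⁻¹ * q r) η))
      (modelIncl E EN N (modelB N μ κ η)) t := by
    refine h1.congr_of_eventuallyEq (Eventually.of_forall fun r => ?_)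
    exact modelIncl_modelAd _ η
  have h3 := ((modelAd EN N (q t)).comp
    (LinearMap.toContinuousLinearMap S)).hasFDerivAt.comp_hasDerivAt t h2
  have hS' : ∀ ξ : EN, ((modelAd EN N (q t)).comp (LinearMap.toContinuousLinearMap S))
      (modelIncl E EN N ξ) = modelAd EN N (q t) ξ := fun ξ =>
    congrArg (modelAd EN N (q t)) (LinearMap.congr_fun hS ξ)
  rw [hS'] at h3
  refine h3.congr_of_eventuallyEq (Eventually.of_forall fun r => ?_)
  change _ = ((modelAd EN N (q t)).comp (LinearMap.toContinuousLinearMap S)) _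
  -- Ad_{q(t)} Ad_{q(t)⁻¹ q(r)} = Ad_{q(r)} undoes the translation of the curve to e.
  rw [hS', ← modelAd_mul hN, mul_inv_cancel_left]

/-- The covariant derivative of the invariant section `σ_η`. -/
theorem hasCovDerivAt_invSection [FiniteDimensional ℝ E] [FiniteDimensional ℝ EK]
    (hμ : IsInvariantMetric μ) {x : ℝ → G ⧸ N} (hx : ContMDiff 𝓘(ℝ, ℝ) 𝓘(ℝ, EK) ∞ x) {t : ℝ}
    {κ : EK} (hκ : HasLogDerivAt x κ t) (η : EN) :
    HasCovDerivAt μ x (fun s => invSection E EN η (x s)) t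
      (invSection E EN (modelB (EN := EN) N μ κ η : EN) (x t)) := by
  obtain ⟨q, hq, hqt, hlift⟩ := exists_horizontal_lift (EN := EN) hπ hμ hx t hκ
  -- σ_η(x(t+s)) = [q(t+s), Ad_{q(t+s)} η]; transport along q keeps the second entry and replaces
  -- q(t+s) by q(t).
  refine ⟨fun s => fiberAt E EN (q t) hqt (modelAd EN N (q (t + s)) η), ?_, ?_⟩
  · filter_upwards [hlift] with s hs
    refine ⟨q, modelAd EN N (q (t + s)) η, hs, ?_, rfl⟩
    rw [invSection_eq_fiberAt (q (t + s)) (hs _ Set.left_mem_uIcc).2.1]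
    rfl
  · rw [invSection_eq_fiberAt (q t) hqt]
    have h1 := hasDerivAt_iff_tendsto_slope_zero.1 (hasDerivAt_modelAd hπ hq η)
    have h2 := ((isHomeomorph_fiberAt (E := E) (EN := EN) (q t) hqt).continuous.tendsto _).comp h1
    refine h2.congr fun s => ?_
    exact (fiberAt_smul_sub (q t) hqt _ _ _).trans (congrArg
      (fun z => s⁻¹ • (fiberAt E EN (q t) hqt (modelAd EN N (q (t + s)) η) - z))
      (invSection_eq_fiberAt (q t) hqt η).symm)

/-- The reduced vertical covariant derivative of `σ_η` is the class of `[κ^{A_N}, η]`. -/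
theorem isReducedVertDeriv_iff [FiniteDimensional ℝ E] [FiniteDimensional ℝ EK]
    (hμ : IsInvariantMetric μ) (κ : EK) (η : EN) (y : AdjQuotient E EN N) :
    IsReducedVertDeriv (EK := EK) μ κ (invSection E EN η) y ↔
      y = quotientIdent E EN (modelB (EN := EN) N μ κ η) := by
  -- Being tangent to the invariant field of κ at time t means having logarithmic derivative κ
  -- there.
  have hlog : ∀ (x : ℝ → G ⧸ N) (t : ℝ), ContMDiff 𝓘(ℝ, ℝ) 𝓘(ℝ, EK) ∞ x →
      (velocity x t = mulInvariantVectorField (I := 𝓘(ℝ, EK)) κ (x t) ↔ HasLogDerivAt x κ t) :=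
    fun x t hx => ⟨fun h => ⟨(hx t).mdifferentiableAt (by simp), h⟩, fun h => h.tderiv_eq⟩
  constructor
  · rintro ⟨w, hw, -, hy⟩
    -- One test curve is enough: it determines w at one point, and y is the class of w at every
    -- point.
    obtain ⟨x, hx, hx0, hxκ⟩ := exists_contMDiff_hasLogDerivAt (1 : G ⧸ N) κ
    have h1 := hw x 0 hx ((hlog x 0 hx).2 hxκ)
    have h2 := h1.unique hπ hμ (hasCovDerivAt_invSection hπ hμ hx hxκ η)
    rw [← hy (x 0), h2]
    exact (quotientIdent_eq E EN _ (x 0)).symm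
  · rintro rfl
    exact ⟨invSection E EN (modelB (EN := EN) N μ κ η),
      fun x t hx hv => hasCovDerivAt_invSection hπ hμ hx ((hlog x t hx).1 hv) η,
      smul_invSection E EN _, fun k => (quotientIdent_eq E EN _ k).symm⟩

end Transport

end LieStages

end

theorem lemma2p2
    {E : Type*} [NormedAddCommGroup E] [NormedSpace ℝ E] [FiniteDimensional ℝ E]
    {EN : Type*} [NormedAddCommGroup EN] [NormedSpace ℝ EN] [FiniteDimensional ℝ EN]
    {EK : Type*} [NormedAddCommGroup EK] [NormedSpace ℝ EK] [FiniteDimensional ℝ EK]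
    -- the Lie group `G`
    {G : Type*} [TopologicalSpace G] [Group G] [ChartedSpace E G] [LieGroup 𝓘(ℝ, E) ∞ G]
    -- the normal Lie subgroup `N`
    (N : Subgroup G) [N.Normal] [ChartedSpace EN N] [LieGroup 𝓘(ℝ, EN) ∞ N]
    [LieStages.IsEmbeddedLieSubgroup E EN N]
    -- the Lie group `K = G ⧸ N`, with the manifold structure for which `G → K` is a submersion
    [ChartedSpace EK (G ⧸ N)] [LieGroup 𝓘(ℝ, EK) ∞ (G ⧸ N)]
    (hπ : IsSubmersion 𝓘(ℝ, E) 𝓘(ℝ, EK) ∞ (fun g : G => (g : G ⧸ N)))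
    -- a `G`-invariant Riemannian metric on `G`
    (μ : LieStages.Metric E G) (hμ : LieStages.IsInvariantMetric μ) :
    -- `A_N(v)` is the unique `η` with `v - η g` horizontal
    (∀ (g : G) (v : TangentSpace 𝓘(ℝ, E) g) (η : GroupLieAlgebra 𝓘(ℝ, EN) N),
      LieStages.connForm EN N μ g v = η ↔
        v - LieStages.vertGen E EN N g η ∈ LieStages.horizontal EN N μ g) ∧
    -- `κ^{A_N}` is the unique horizontal vector in `𝔤` over `κ`
    (∀ (κ : GroupLieAlgebra 𝓘(ℝ, EK) (G ⧸ N)) (u : GroupLieAlgebra 𝓘(ℝ, E) G),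
      LieStages.horLift EN μ κ = u ↔
        u ∈ LieStages.horizontal EN N μ 1 ∧ LieStages.projLie E EK N u = κ) ∧
    -- `[κ^{A_N}, η]` lies in `𝔫`, and it is the reduced vertical derivative of `η ≡ [σ_η]_K`
    (∀ (κ : GroupLieAlgebra 𝓘(ℝ, EK) (G ⧸ N)) (η : GroupLieAlgebra 𝓘(ℝ, EN) N),
      LieStages.inclLie E EN N (LieStages.bForm μ κ η) =
          ⁅LieStages.horLift EN μ κ, LieStages.inclLie E EN N η⁆ ∧
        ∀ y : LieStages.AdjQuotient E EN N,
          LieStages.IsReducedVertDeriv μ κ (LieStages.invSection E EN η) y ↔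
            y = LieStages.quotientIdent E EN (LieStages.bForm μ κ η)) ∧
    -- the bracket formula, under the identification `κ ⊕ η ≡ κ^{A_N} + η`
    ∃ Φ : (GroupLieAlgebra 𝓘(ℝ, EK) (G ⧸ N) × GroupLieAlgebra 𝓘(ℝ, EN) N) ≃ₗ[ℝ]
        GroupLieAlgebra 𝓘(ℝ, E) G,
      (∀ κ η, Φ (κ, η) = LieStages.horLift EN μ κ + LieStages.inclLie E EN N η) ∧
      ∀ (κ κ' : GroupLieAlgebra 𝓘(ℝ, EK) (G ⧸ N)) (η η' : GroupLieAlgebra 𝓘(ℝ, EN) N),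
        ⁅Φ (κ, η), Φ (κ', η')⁆ =
          Φ (⁅κ, κ'⁆, LieStages.bForm μ κ η' - LieStages.bForm μ κ' η
            - LieStages.aForm EN μ κ κ' + ⁅η, η'⁆) := by
  have : CompleteSpace E := FiniteDimensional.complete ℝ E
  have : CompleteSpace EK := FiniteDimensional.complete ℝ EK
  exact ⟨fun g v η => LieStages.connForm_eq_iff g v η,
    fun κ u => LieStages.modelLift_eq_iff (E := E) (EN := EN) (EK := EK) hπ κ u,
    fun κ η => ⟨LieStages.modelIncl_modelB (E := E) (EN := EN) (EK := EK) hπ κ η,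
      fun y => LieStages.isReducedVertDeriv_iff (E := E) (EN := EN) (EK := EK) hπ hμ κ η y⟩,
    LieStages.splitting (E := E) (EK := EK) EN μ hπ,
    fun κ η => LieStages.splitting_apply (E := E) (EN := EN) (EK := EK) hπ κ η,
    fun κ κ' η η' =>
      LieStages.modelBracket_splitting (E := E) (EN := EN) (EK := EK) hπ κ κ' η η'⟩
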